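/- **Setting.** All functions are complex-valued superfunctions: finite sums of smooth functions of finitely many real even coordinates times elements of the Grassmann algebra of the odd coordinates; $\mathsf p$ denotes parity. Let $J^\infty$ be the infinite jet space with even independent variables $x^1,\dots,x^{n}$, even unknowns $u^1,\dots,u^{m_0}$ and odd unknowns $\xi^1,\dots,\xi^{m_1}$ (in local coordinates $x^i,u^k_I,\xi^a_I$), with total derivatives $D_{x^i}$. Let $\mathcal E=\{F^\ell=0\}$ be a finite system of partial differential equations with homogeneous $F^\ell$. "On $\mathcal E^\infty$" means modulo the ideal generated by the $F^\ell$ and all their differential consequences $D_{x^I}F^\ell$. Let $\mathfrak g\subseteq\mathfrak{gl}(k_0+1|k_1)$ be a finite-dimensional complex Lie superalgebra with a homogeneous basis $e_1,\dots,e_r$, let $\rho$ be a faithful representation of $\mathfrak g$ by matrices of size $(k_0+1|k_1)$, and let $\varrho$ be a representation of $\mathfrak g$ by vector fields with polynomial coefficients on the $(k_0|k_1)$-dimensional superspace $W$ with even coordinates $w^1,\dots,w^{k_0}$ and odd coordinates $f^1,\dots,f^{k_1}$. Repeated indices are summed, and functions are written to the left of the $e_k$, so that $[f e_i,g e_k]=(-1)^{\mathsf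 p(e_i)\mathsf p(g)}fg\,[e_i,e_k]$. Let $\alpha_\lambda=\sum_i dx^i\,a^k_i\,\rho(e_k)$, $\lambda\in\mathcal I\subseteq\mathbb C$, be a family of zero-curvature representations for $\mathcal E$ that is smooth and differentiable with respect to $\lambda$. Here $a_i^k=a_i^k(\lambda)$ are functions on $J^\infty$ with $\mathsf p(a^k_i)=\mathsf p(e_k)$, and $\bar d_h\alpha_\lambda=\frac12[\alpha_\lambda,\alpha_\lambda]$ on $\mathcal E^\infty$. It determines the covering $\tilde{\mathcal E}=W\times\mathcal E^\infty\to\mathcal E^\infty$ with the prolonged total derivatives $$\tilde D_{x^i}=\bar D_{x^i}-a^k_i\,\varrho(e_k)$$ (that is, $w^p_{x^i}=-a_i^k\,\varrho(e_k)(w^p)$ and $f^q_{x^i}=-a_i^k\,\varrho(e_k)(f^q)$), and the characteristic element $U_\lambda$ of this covering is the derivation from functions on $\tilde{\mathcal E}$ to one-forms on $\tilde{\mathcal E}$ $$U_\lambda(f)=df-\sum_i dx^i\,\tilde D_{x^i}(f).$$ For an even vector field $X$ and an even derivation $U$ from functions to one-forms the Frölicher–Nijenhuis bracket is $[X,U]^{\mathrm{FN}}(f)=L_X(U(f))-U(X(f))$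 with $L_X=i_X\circ d+d\circ i_X$. **Proposition.** Suppose that the parameter $\lambda$ is removable, as witnessed for every $\lambda\in\mathcal I$ by an even $\mathfrak g$-matrix $Q_\lambda=q^k\rho(e_k)$ (where $q^k$ are functions with $\mathsf p(q^k)=\mathsf p(e_k)$) such that $$\frac{d}{d\lambda}\alpha_\lambda=\bar d_hQ_\lambda-[\alpha_\lambda,Q_\lambda]\quad\text{on }\mathcal E^\infty .$$ Then for every $\lambda\in\mathcal I$ the vector field $X_\lambda=q^k\varrho(e_k)$ on $\tilde{\mathcal E}$ satisfies the structure equation $$\frac{d}{d\lambda}U_\lambda=[X_\lambda,U_\lambda]^{\mathrm{FN}} .$$ -/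

import Mathlib

noncomputable section

namespace SuperPDE

open scoped TensorProduct ContDiff

/-! ### Calculus on the superdomain with even coordinates `E` and odd coordinates `O` -/

section Calculus

variable (E O : Type)

/-- Complex-valued smooth functions of real coordinates indexed by `E`, each of them depending on
finitely many coordinates only. -/
def SmoothFun : Subalgebra ℂ ((E → ℝ) → ℂ) where
  carrier := {f | ∃ (S : Finset E) (φ : (S → ℝ) → ℂ), ContDiff ℝ ∞ φ ∧
    ∀ p, f p = φ (fun s => p s)}
  mul_mem' := by
    classical
    rintro f g ⟨S, φ, hφ, hf⟩ ⟨T, ψ, hψ, hg⟩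
    refine ⟨S ∪ T, fun y => φ (fun s => y ⟨s, Finset.mem_union_left _ s.2⟩) *
      ψ (fun s => y ⟨s, Finset.mem_union_right _ s.2⟩), ?_, fun p => by simp [hf, hg]⟩
    exact (hφ.comp (by fun_prop)).mul (hψ.comp (by fun_prop))
  add_mem' := by
    classical
    rintro f g ⟨S, φ, hφ, hf⟩ ⟨T, ψ, hψ, hg⟩
    refine ⟨S ∪ T, fun y => φ (fun s => y ⟨s, Finset.mem_union_left _ s.2⟩) +
      ψ (fun s => y ⟨s, Finset.mem_union_right _ s.2⟩), ?_, fun p => by simp [hf, hg]⟩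
    exact (hφ.comp (by fun_prop)).add (hψ.comp (by fun_prop))
  algebraMap_mem' c := ⟨∅, fun _ => c, contDiff_const, fun p => rfl⟩

/-- The Grassmann algebra with (anticommuting) generators indexed by `O`. -/
abbrev Grassmann : Type := ExteriorAlgebra ℂ (O →₀ ℂ)

/-- The algebra of superfunctions: finite sums of smooth functions of the even coordinates times
elements of the Grassmann algebra of the odd coordinates. -/
def SuperFun : Type := SmoothFun E ⊗[ℂ] Grassmann O

instance : Ring (SuperFun E O) := inferInstanceAs (Ring (SmoothFun E ⊗[ℂ] Grassmann O))

instance : Algebra ℂ (SuperFun E O) := inferInstanceAs (Algebra ℂ (SmoothFun E ⊗[ℂ] Grassmann O))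

variable {E O}

/-- The product of a smooth function and an element of the Grassmann algebra. -/
def SuperFun.tmul (f : SmoothFun E) (w : Grassmann O) : SuperFun E O := f ⊗ₜ[ℂ] w

theorem SuperFun.induction {P : SuperFun E O → Prop} (f : SuperFun E O) (zero : P 0)
    (tmul : ∀ g w, P (SuperFun.tmul g w)) (add : ∀ x y, P x → P y → P (x + y)) : P f :=
  TensorProduct.induction_on (motive := P) f zero tmul add

theorem SmoothFun.hasDerivAt [DecidableEq E] {f : (E → ℝ) → ℂ} {S : Finset E}
    {φ : (S → ℝ) → ℂ} (hφ : ContDiff ℝ ∞ φ) (hf : ∀ p, f p = φ (fun s => p s))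
    (e : E) (p : E → ℝ) :
    HasDerivAt (fun t => f (Function.update p e t))
      (fderiv ℝ φ (fun s => p s) (fun s => if (s : E) = e then 1 else 0)) (p e) := by
  have h1 : HasDerivAt (fun t => (fun s : S => Function.update p e t s))
      (fun s => if (s : E) = e then 1 else 0) (p e) := by
    rw [hasDerivAt_pi]
    intro s
    by_cases h : (s : E) = e
    · subst h
      simpa using hasDerivAt_id' (p s)
    · simpa [h, Function.update_of_ne h] using hasDerivAt_const (p e) (p s)
  have h2 : HasFDerivAt φ (fderiv ℝ φ (fun s => p s))
      (fun s : S => Function.update p e (p e) s) := by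
    simpa using (hφ.differentiable (by simp) (fun s => p s)).hasFDerivAt
  have h3 := h2.comp_hasDerivAt (p e) h1
  refine h3.congr_of_eventuallyEq (Filter.Eventually.of_forall fun t => ?_)
  simp [hf]

/-- The partial derivative with respect to the even coordinate `e`, on smooth functions. -/
def pderivEven [DecidableEq E] (e : E) : SmoothFun E →ₗ[ℂ] SmoothFun E where
  toFun f := ⟨fun p => deriv (fun t => f.1 (Function.update p e t)) (p e), by
    obtain ⟨S, φ, hφ, hf⟩ := f.2
    refine ⟨S, fun y => fderiv ℝ φ y (fun s => if (s : E) = e then 1 else 0), ?_, fun p =>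
      (SmoothFun.hasDerivAt hφ hf e p).deriv⟩
    exact (hφ.fderiv_right (m := ∞) (by simp)).clm_apply contDiff_const⟩
  map_add' f g := by
    ext p
    obtain ⟨S, φ, hφ, hf⟩ := f.2
    obtain ⟨T, ψ, hψ, hg⟩ := g.2
    exact ((SmoothFun.hasDerivAt hφ hf e p).differentiableAt.hasDerivAt.add
      (SmoothFun.hasDerivAt hψ hg e p).differentiableAt.hasDerivAt).deriv
  map_smul' c f := by
    ext p
    obtain ⟨S, φ, hφ, hf⟩ := f.2
    exact ((SmoothFun.hasDerivAt hφ hf e p).differentiableAt.hasDerivAt.const_smul c).deriv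

/-- The (left) partial derivative with respect to the odd coordinate `o`, on the Grassmann
algebra: `∂/∂θ^o (θ^j b) = δ_o^j b - θ^j ∂b/∂θ^o`. -/
def pderivOdd (o : O) : Grassmann O →ₗ[ℂ] Grassmann O :=
  CliffordAlgebra.contractLeft (Q := (0 : QuadraticForm ℂ (O →₀ ℂ))) (Finsupp.lapply o)

/-- The partial derivatives with respect to all coordinates `z^j` (even: `Sum.inl`, odd: `Sum.inr`),
on superfunctions. -/
def pderiv [DecidableEq E] : E ⊕ O → (SuperFun E O →ₗ[ℂ] SuperFun E O)
  | Sum.inl e => LinearMap.rTensor (Grassmann O) (pderivEven e)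
  | Sum.inr o => LinearMap.lTensor (SmoothFun E) (pderivOdd o)

/-- The coordinates `z^j` as superfunctions. -/
def coord : E ⊕ O → SuperFun E O
  | Sum.inl e => SuperFun.tmul (⟨fun p => (p e : ℂ), by
      exact ⟨{e}, fun y => (y ⟨e, by simp⟩ : ℂ), Complex.ofRealCLM.contDiff.comp (by fun_prop),
        fun _ => rfl⟩⟩ : SmoothFun E) 1
  | Sum.inr o => SuperFun.tmul 1 (ExteriorAlgebra.ι ℂ (Finsupp.single o 1))

/-- The parity of an index: `0` for even ones, `1` for odd ones. -/
def par {A B : Type} : A ⊕ B → ZMod 2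
  | Sum.inl _ => 0
  | Sum.inr _ => 1

/-- The sign `(-1)^{pq}`. -/
def sgn (p q : ZMod 2) : ℂ := if p = 1 ∧ q = 1 then -1 else 1

/-- The parity automorphism of the algebra of superfunctions: `f ↦ (-1)^{p(f)} f`. -/
def parityAut : SuperFun E O →ₐ[ℂ] SuperFun E O :=
  Algebra.TensorProduct.map (AlgHom.id ℂ (SmoothFun E))
    (CliffordAlgebra.involute (Q := (0 : QuadraticForm ℂ (O →₀ ℂ))))

/-- The automorphism `f ↦ (-1)^{p · p(f)} f`. -/
def twist (p : ZMod 2) : SuperFun E O →ₐ[ℂ] SuperFun E O :=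
  if p = 1 then parityAut else AlgHom.id ℂ _

/-- `f` is homogeneous of parity `p`. -/
def HasParity (p : ZMod 2) (f : SuperFun E O) : Prop := parityAut f = sgn 1 p • f

/-- Pull-back of superfunctions along the projection of coordinate spaces
that forgets the coordinates outside the images of `e` and `o`. -/
def pull {E' O' : Type} (e : E → E') (o : O → O') : SuperFun E O →ₐ[ℂ] SuperFun E' O' :=
  Algebra.TensorProduct.map
    ({ toFun := fun f => ⟨fun p => f.1 (fun i => p (e i)), by
          classical
          obtain ⟨S, φ, hφ, hf⟩ := f.2
          refine ⟨S.image e, fun y => φ (fun s => y ⟨e s, Finset.mem_image_of_mem e s.2⟩),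
            hφ.comp (by fun_prop), fun p => by simp [hf]⟩⟩
       map_one' := rfl
       map_mul' := fun _ _ => rfl
       map_zero' := rfl
       map_add' := fun _ _ => rfl
       commutes' := fun _ => rfl } : SmoothFun E →ₐ[ℂ] SmoothFun E')
    (ExteriorAlgebra.map (Finsupp.lmapDomain ℂ ℂ o))

theorem pderivEven_eq_zero [DecidableEq E] (f : SmoothFun E) :
    {e : E | pderivEven e f ≠ 0}.Finite := by
  obtain ⟨S, φ, hφ, hf⟩ := f.2
  refine S.finite_toSet.subset fun e he => ?_
  by_contra hS
  refine he ?_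
  ext p
  refine (SmoothFun.hasDerivAt hφ hf e p).deriv.trans ?_
  have : (fun s : S => if (s : E) = e then (1 : ℝ) else 0) = 0 := by
    funext s
    have : (s : E) ≠ e := fun h => hS (h ▸ s.2)
    simp [this]
  rw [this]
  simp

theorem pderivOdd_eq_zero (w : Grassmann O) : {o : O | pderivOdd o w ≠ 0}.Finite := by
  induction w using CliffordAlgebra.left_induction with
  | algebraMap r =>
    convert Set.finite_empty
    ext o
    simp [pderivOdd]
  | add x y hx hy =>
    refine (hx.union hy).subset fun o ho => ?_
    by_contra h
    simp only [Set.mem_union, Set.mem_ofPred_eq, not_or, not_not] at h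
    exact ho (by rw [map_add, h.1, h.2, add_zero])
  | ι_mul x m hx =>
    refine (hx.union m.support.finite_toSet).subset fun o ho => ?_
    by_contra h
    simp only [Set.mem_union, Set.mem_ofPred_eq, not_or, not_not, Finset.mem_coe,
      Finsupp.notMem_support_iff] at h
    refine ho ?_
    have h1 := h.1
    unfold pderivOdd at h1 ⊢
    rw [CliffordAlgebra.contractLeft_ι_mul, h1]
    simp [h.2]

theorem pderiv_finite [DecidableEq E] (f : SuperFun E O) :
    {j : E ⊕ O | pderiv j f ≠ 0}.Finite := by
  induction f using SuperFun.induction with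
  | zero => simp only [map_zero, ne_eq, not_true_eq_false]; exact Set.finite_empty
  | tmul f w =>
    refine (((pderivEven_eq_zero f).image Sum.inl).union
      ((pderivOdd_eq_zero w).image Sum.inr)).subset ?_
    rintro (e | o) h
    · refine Or.inl ⟨e, fun h0 => h ?_, rfl⟩
      change pderivEven e f ⊗ₜ[ℂ] w = 0
      rw [h0, TensorProduct.zero_tmul]
    · refine Or.inr ⟨o, fun h0 => h ?_, rfl⟩
      change f ⊗ₜ[ℂ] pderivOdd o w = 0
      rw [h0, TensorProduct.tmul_zero]
  | add x y hx hy =>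
    refine (hx.union hy).subset fun o ho => ?_
    by_contra h
    simp only [Set.mem_union, Set.mem_ofPred_eq, not_or, not_not] at h
    exact ho (by rw [map_add, h.1, h.2, add_zero])

/-! ### Vector fields and differential forms -/

variable (E O)

/-- A vector field `∑_j X^j ∂/∂z^j`, given by its coefficients `X^j = X(z^j)`. -/
abbrev VectorField : Type := E ⊕ O → SuperFun E O

/-- A differential one-form `∑_j dz^j η_j` (finite sum), given by its coefficients `η_j`. -/
abbrev Form1 : Type := (E ⊕ O) →₀ SuperFun E O

variable {E O}

/-- Right multiplication of one-forms by functions: `(dz^j η_j) f = dz^j (η_j f)`. -/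
def Form1.mulRight (η : Form1 E O) (f : SuperFun E O) : Form1 E O :=
  η.mapRange (fun h => h * f) (zero_mul f)

/-- Left multiplication of one-forms by functions: `f (dz^j η_j) = (-1)^{p(f)p(z^j)} dz^j (f η_j)`. -/
def Form1.mulLeft (f : SuperFun E O) : Form1 E O →ₗ[ℂ] Form1 E O :=
  Finsupp.lsum ℂ fun j =>
    (Finsupp.lsingle j).comp (LinearMap.mulLeft ℂ (twist (par j) f))

/-- The de Rham differential on functions, `df = ∑_j dz^j ∂f/∂z^j`. -/
def d0 [DecidableEq E] : SuperFun E O →ₗ[ℂ] Form1 E O where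
  toFun f := Finsupp.onFinset (pderiv_finite f).toFinset (fun j => pderiv j f) (by simp)
  map_add' f g := by ext j; simp
  map_smul' c f := by ext j; simp

/-- The action of a vector field on functions, `X(f) = ∑_j X^j ∂f/∂z^j`. -/
def VectorField.apply [DecidableEq E] (X : VectorField E O) (f : SuperFun E O) : SuperFun E O :=
  (d0 f).sum fun j h => X j * h

/-- The coefficients of the bracket `[X, Y] = X ∘ Y - (-1)^{pq} Y ∘ X` of vector fields `X`, `Y` of
parities `p`, `q`. -/
def VectorField.bracket [DecidableEq E] (p q : ZMod 2) (X Y : VectorField E O) :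
    VectorField E O :=
  fun j => X.apply (Y j) - sgn p q • Y.apply (X j)

/-- The vector field is homogeneous of parity `p`. -/
def VectorField.HasParity (p : ZMod 2) (X : VectorField E O) : Prop :=
  ∀ j, SuperPDE.HasParity (p + par j) (X j)

variable (E O)

/-- Even vector fields. -/
structure EvenField where
  coef : VectorField E O
  even : coef.HasParity 0

/-- The relations `dz^j ∧ dz^k = - (-1)^{p(z^j)p(z^k)} dz^k ∧ dz^j`. -/
def wedgeRel : Submodule ℂ (((E ⊕ O) × (E ⊕ O)) →₀ SuperFun E O) :=
  Submodule.span ℂ {c | ∃ (j k : E ⊕ O) (h : SuperFun E O),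
    c = Finsupp.single (j, k) h + sgn (par j) (par k) • Finsupp.single (k, j) h}

/-- Differential two-forms `∑ dz^j ∧ dz^k η_{jk}`. -/
abbrev Form2 : Type := (((E ⊕ O) × (E ⊕ O)) →₀ SuperFun E O) ⧸ wedgeRel E O

variable {E O}

/-- The de Rham differential on one-forms, `d (dz^j h) = - ∑_k dz^j ∧ dz^k ∂h/∂z^k`. -/
def d1 [DecidableEq E] : Form1 E O →ₗ[ℂ] Form2 E O :=
  (wedgeRel E O).mkQ.comp (Finsupp.lsum ℂ fun j =>
    -(Finsupp.lmapDomain (SuperFun E O) ℂ (fun k => (j, k))).comp d0)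

/-- The substitution of a vector field into one-forms, `i_X (dz^j h) = X^j h`. -/
def EvenField.i1 (X : EvenField E O) : Form1 E O →ₗ[ℂ] SuperFun E O :=
  Finsupp.lsum ℂ fun j => LinearMap.mulLeft ℂ (X.coef j)

theorem twist_of_hasParity {p q : ZMod 2} {f : SuperFun E O} (h : HasParity q f) :
    twist p f = sgn p q • f := by
  unfold twist
  split_ifs with hp
  · rw [hp]; exact h
  · simp [sgn, hp]

/-- The substitution of an even vector field into two-forms,
`i_X (dz^j ∧ dz^k h) = X^j dz^k h - dz^j X^k h`. -/
def EvenField.i2 (X : EvenField E O) : Form2 E O →ₗ[ℂ] Form1 E O :=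
  (wedgeRel E O).liftQ
    (Finsupp.lsum ℂ fun jk : (E ⊕ O) × (E ⊕ O) =>
      (Form1.mulLeft (X.coef jk.1)).comp (Finsupp.lsingle jk.2) -
        (Finsupp.lsingle jk.1).comp (LinearMap.mulLeft ℂ (X.coef jk.2)))
    (by
      rw [wedgeRel, Submodule.span_le]
      rintro _ ⟨j, k, h, rfl⟩
      have h1 : ∀ i l : E ⊕ O, twist (par i) (X.coef l) = sgn (par i) (par l) • X.coef l := fun i l =>
        twist_of_hasParity (by have := X.even l; rwa [zero_add] at this)
      have h2 : sgn (par j) (par k) = sgn (par k) (par j) := by simp [sgn, and_comm]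
      have h3 : sgn (par k) (par j) * sgn (par k) (par j) = 1 := by
        unfold sgn; split_ifs <;> norm_num
      simp only [SetLike.mem_coe, LinearMap.mem_ker, map_add, map_smul, Finsupp.lsum_single,
        LinearMap.sub_apply, LinearMap.comp_apply, Finsupp.lsingle_apply, Form1.mulLeft,
        LinearMap.mulLeft_apply, h1, h2, smul_mul_assoc, smul_sub,
        smul_smul, h3, one_smul]
      abel)

/-- The Lie derivative along an even vector field on one-forms, `L_X = i_X ∘ d + d ∘ i_X`. -/
def EvenField.lie [DecidableEq E] (X : EvenField E O) (η : Form1 E O) : Form1 E O :=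
  X.i2 (d1 η) + d0 (X.i1 η)

/-- The Frölicher-Nijenhuis bracket `[X, Θ](f) = L_X (Θ(f)) - L_Θ (X(f))` of an even vector field
`X` and an even derivation `Θ` from functions to one-forms. On a function `h` one has
`i_Θ h = 0` and `i_Θ (dh) = Θ(h)`, so that `L_Θ h = i_Θ (dh) + d (i_Θ h) = Θ(h)`. -/
def fnBracket [DecidableEq E] (X : EvenField E O) (Θ : SuperFun E O → Form1 E O) :
    SuperFun E O → Form1 E O :=
  fun f => X.lie (Θ f) - Θ (X.coef.apply f)

/-! ### Families of functions and forms, and their derivative with respect to the parameter -/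

/-- `c` is a smooth family, with parameter in `I`, of smooth functions,
and `c'` is its derivative with respect to the parameter. -/
def HasParamDerivSmooth (I : Set ℂ) (c c' : ℂ → SmoothFun E) : Prop :=
  (∃ (S : Finset E) (φ : ℂ × (S → ℝ) → ℂ), ContDiffOn ℝ ∞ φ (I ×ˢ Set.univ) ∧
    ∀ l ∈ I, ∀ p, (c l).1 p = φ (l, fun s => p s)) ∧
  ∀ l ∈ I, ∀ p, HasDerivWithinAt (fun m => (c m).1 p) ((c' l).1 p) I l

/-- `f` is a smooth family, with parameter in `I`, of superfunctions, and `f'` is its derivative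
with respect to the parameter (which is computed coefficientwise in the Grassmann algebra). -/
def HasParamDeriv (I : Set ℂ) (f f' : ℂ → SuperFun E O) : Prop :=
  ∃ (N : ℕ) (c c' : Fin N → ℂ → SmoothFun E) (w : Fin N → Grassmann O),
    (∀ j, HasParamDerivSmooth I (c j) (c' j)) ∧
    ∀ l ∈ I, f l = ∑ j, c j l ⊗ₜ[ℂ] w j ∧ f' l = ∑ j, c' j l ⊗ₜ[ℂ] w j

/-- `η` is a smooth family, with parameter in `I`, of one-forms, and `η'` is its derivative
with respect to the parameter. -/
def HasParamDerivForm (I : Set ℂ) (η η' : ℂ → Form1 E O) : Prop :=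
  (∃ S : Finset (E ⊕ O), ∀ l ∈ I, (η l).support ⊆ S ∧ (η' l).support ⊆ S) ∧
  ∀ j, HasParamDeriv I (fun l => η l j) (fun l => η' l j)

end Calculus

/-! ### Jets and differential equations -/

/-- Even coordinates on the infinite jet space: the independent variables `x^i`, and `u^k_I`. -/
abbrev JetE (n m₀ : ℕ) : Type := Fin n ⊕ (Fin m₀ × (Fin n → ℕ))

/-- Odd coordinates on the infinite jet space: `ξ^a_I`. -/
abbrev JetO (n m₁ : ℕ) : Type := Fin m₁ × (Fin n → ℕ)

/-- Functions on the infinite jet space. -/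
abbrev JetFun (n m₀ m₁ : ℕ) : Type := SuperFun (JetE n m₀) (JetO n m₁)

/-- The total derivative `D_{x^i}`. -/
def totalD {n m₀ m₁ : ℕ} (i : Fin n) : VectorField (JetE n m₀) (JetO n m₁)
  | Sum.inl (Sum.inl j) => if j = i then 1 else 0
  | Sum.inl (Sum.inr (k, I)) => coord (Sum.inl (Sum.inr (k, I + Pi.single i 1)))
  | Sum.inr (a, I) => coord (Sum.inr (a, I + Pi.single i 1))

/-- A system of `r` partial differential equations `F^ℓ = 0`, each of them even or odd. -/
structure PDESystem (n m₀ m₁ : ℕ) where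
  r : ℕ
  F : Fin r → JetFun n m₀ m₁
  parity : Fin r → ZMod 2
  homogeneous : ∀ l, HasParity (parity l) (F l)

/-- The left-hand sides of the equations and of all their differential consequences. -/
inductive PDESystem.Consequence {n m₀ m₁ : ℕ} (𝓔 : PDESystem n m₀ m₁) : JetFun n m₀ m₁ → Prop
  | eqn (l : Fin 𝓔.r) : 𝓔.Consequence (𝓔.F l)
  | total (i : Fin n) (f : JetFun n m₀ m₁) : 𝓔.Consequence f →
      𝓔.Consequence ((totalD i).apply f)

/-- The function `f` on the jet space vanishes on the infinite prolongation `𝓔^∞`: it belongs to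
the ideal generated by the equations and all their differential consequences. -/
def PDESystem.Vanishes {n m₀ m₁ : ℕ} (𝓔 : PDESystem n m₀ m₁) (f : JetFun n m₀ m₁) : Prop :=
  f ∈ TwoSidedIdeal.span {h | 𝓔.Consequence h}

/-! ### Matrix Lie superalgebras and their representations -/

/-- Complex matrices of the size `(k₀+1|k₁) × (k₀+1|k₁)` with entries in `R`. -/
abbrev Mat (k₀ k₁ : ℕ) (R : Type) : Type :=
  Matrix (Fin (k₀ + 1) ⊕ Fin k₁) (Fin (k₀ + 1) ⊕ Fin k₁) R

/-- The complex matrix is homogeneous of parity `p`. -/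
def MatParity {k₀ k₁ : ℕ} (p : ZMod 2) (A : Mat k₀ k₁ ℂ) : Prop :=
  ∀ s t, A s t ≠ 0 → par s + par t = p

/-- The even part of a complex matrix. -/
def evenPart {k₀ k₁ : ℕ} (A : Mat k₀ k₁ ℂ) : Mat k₀ k₁ ℂ :=
  fun s t => if par s + par t = 0 then A s t else 0

/-- The supercommutator of matrices `A`, `B` of parities `p`, `q`. -/
def superComm {k₀ k₁ : ℕ} (p q : ZMod 2) (A B : Mat k₀ k₁ ℂ) : Mat k₀ k₁ ℂ :=
  A * B - sgn p q • (B * A)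

/-- A Lie superalgebra `𝔤 ⊆ 𝔤𝔩(k₀+1|k₁)`: a graded subspace that is closed under the
supercommutator. -/
structure MatLieSuper (k₀ k₁ : ℕ) where
  space : Submodule ℂ (Mat k₀ k₁ ℂ)
  graded : ∀ A ∈ space, evenPart A ∈ space
  bracket_mem : ∀ p q A B, A ∈ space → B ∈ space → MatParity p A → MatParity q B →
    superComm p q A B ∈ space

namespace MatLieSuper

variable {k₀ k₁ : ℕ} (𝔤 : MatLieSuper k₀ k₁)

/-- A basis `e_1, …, e_r` of `𝔤` that consists of homogeneous elements. -/
structure HomBasis (r : ℕ) where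
  e : Module.Basis (Fin r) ℂ 𝔤.space
  parity : Fin r → ZMod 2
  homogeneous : ∀ k, MatParity (parity k) (e k).1

/-- A faithful representation `ρ` of `𝔤` by matrices of size `(k₀+1|k₁)`. -/
structure MatRep where
  map : 𝔤.space →ₗ[ℂ] Mat k₀ k₁ ℂ
  injective : Function.Injective map
  parity : ∀ (p : ZMod 2) (A : 𝔤.space), MatParity p A.1 → MatParity p (map A)
  bracket : ∀ (p q : ZMod 2) (A B : 𝔤.space) (hA : MatParity p A.1) (hB : MatParity q B.1),
    map ⟨superComm p q A.1 B.1, 𝔤.bracket_mem p q A B A.2 B.2 hA hB⟩ =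
      superComm p q (map A) (map B)

/-- A representation `ϱ` of `𝔤` by vector fields with polynomial coefficients on the
`(k₀|k₁)`-dimensional superspace `W` with even coordinates `w^1, …, w^{k₀}` and odd coordinates
`f^1, …, f^{k₁}`. -/
structure VectRep where
  map : 𝔤.space →ₗ[ℂ] VectorField (Fin k₀) (Fin k₁)
  polynomial : ∀ A j, map A j ∈ Algebra.adjoin ℂ (Set.range (coord (E := Fin k₀) (O := Fin k₁)))
  parity : ∀ (p : ZMod 2) (A : 𝔤.space), MatParity p A.1 → (map A).HasParity p
  bracket : ∀ (p q : ZMod 2) (A B : 𝔤.space) (hA : MatParity p A.1) (hB : MatParity q B.1),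
    map ⟨superComm p q A.1 B.1, 𝔤.bracket_mem p q A B A.2 B.2 hA hB⟩ =
      VectorField.bracket p q (map A) (map B)

end MatLieSuper

/-! ### Zero-curvature representations -/

section ZCR

variable {n m₀ m₁ k₀ k₁ r : ℕ} {𝔤 : MatLieSuper k₀ k₁}

/-- An even `𝔤`-valued function `∑_k q^k ⊗ e_k` on the jet space, given by its coefficients `q^k`
(the parity of `q^k` is that of `e_k`). -/
structure GFun (n m₀ m₁ : ℕ) (b : 𝔤.HomBasis r) where
  coef : Fin r → JetFun n m₀ m₁
  even : ∀ k, HasParity (b.parity k) (coef k)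

/-- The matrix `∑_k q^k ρ(e_k)`. -/
def gMatrix (b : 𝔤.HomBasis r) (ρ : 𝔤.MatRep) (q : Fin r → JetFun n m₀ m₁) :
    Mat k₀ k₁ (JetFun n m₀ m₁) :=
  fun s t => ∑ k, ρ.map (b.e k) s t • q k

/-- The product of matrices with entries in the superfunctions, where a function `f` times a complex
matrix `A` is the matrix of entries `A_{st} f`:
`(f A) (g B) = (-1)^{p(A)p(g)} (f g) (A B)`. -/
def superMul (M N : Mat k₀ k₁ (JetFun n m₀ m₁)) : Mat k₀ k₁ (JetFun n m₀ m₁) :=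
  fun s u => ∑ t, M s t * twist (par s + par t) (N t u)

/-- The bracket `[M, N] = M N - N M` of even matrices. -/
def evenBracket (M N : Mat k₀ k₁ (JetFun n m₀ m₁)) : Mat k₀ k₁ (JetFun n m₀ m₁) :=
  superMul M N - superMul N M

/-- The total derivative `D_{x^i}` of a matrix, entry by entry. -/
def totalDMat (i : Fin n) (M : Mat k₀ k₁ (JetFun n m₀ m₁)) : Mat k₀ k₁ (JetFun n m₀ m₁) :=
  M.map fun f => (totalD i).apply f

/-- The matrix vanishes on `𝓔^∞`. -/
def PDESystem.MatVanishes (𝓔 : PDESystem n m₀ m₁) (M : Mat k₀ k₁ (JetFun n m₀ m₁)) : Prop :=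
  ∀ s t, 𝓔.Vanishes (M s t)

/-- The horizontal form `α = ∑_i dx^i α_i` is a zero-curvature representation for `𝓔`: the
Maurer-Cartan condition `d_h α = 1/2 [α, α]`, that is, `D_i α_j - D_j α_i = [α_i, α_j]` for all
`i` and `j`, holds on `𝓔^∞`. -/
def IsZCR (𝓔 : PDESystem n m₀ m₁) (α : Fin n → Mat k₀ k₁ (JetFun n m₀ m₁)) : Prop :=
  ∀ i j, 𝓔.MatVanishes
    (totalDMat i (α j) - totalDMat j (α i) - evenBracket (α i) (α j))

/-- The equation `α' = d_h Q - [α, Q]` holds on `𝓔^∞`, for horizontal forms `α = ∑_i dx^i α_i`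
and `α' = ∑_i dx^i α'_i`. -/
def MarvanEq (𝓔 : PDESystem n m₀ m₁) (α α' : Fin n → Mat k₀ k₁ (JetFun n m₀ m₁))
    (Q : Mat k₀ k₁ (JetFun n m₀ m₁)) : Prop :=
  ∀ i, 𝓔.MatVanishes (α' i - (totalDMat i Q - evenBracket (α i) Q))

end ZCR

/-! ### Coverings -/

/-- Even coordinates on the product of the infinite jet space and `W`. -/
abbrev CovE (n m₀ k₀ : ℕ) : Type := JetE n m₀ ⊕ Fin k₀

/-- Odd coordinates on the product of the infinite jet space and `W`. -/
abbrev CovO (n m₁ k₁ : ℕ) : Type := JetO n m₁ ⊕ Fin k₁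

section Covering

variable {n m₀ m₁ k₀ k₁ r : ℕ} {𝔤 : MatLieSuper k₀ k₁}

/-- The pull-back of functions along the projection onto the jet space. -/
def fromJet : JetFun n m₀ m₁ →ₐ[ℂ] SuperFun (CovE n m₀ k₀) (CovO n m₁ k₁) :=
  pull Sum.inl Sum.inl

/-- The pull-back of functions along the projection onto `W`. -/
def fromW : SuperFun (Fin k₀) (Fin k₁) →ₐ[ℂ] SuperFun (CovE n m₀ k₀) (CovO n m₁ k₁) :=
  pull Sum.inr Sum.inr

/-- The vector field with coefficients `H^j` along the jet space and `V^j` along `W`. -/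
def combine (H : JetE n m₀ ⊕ JetO n m₁ → SuperFun (CovE n m₀ k₀) (CovO n m₁ k₁))
    (V : Fin k₀ ⊕ Fin k₁ → SuperFun (CovE n m₀ k₀) (CovO n m₁ k₁)) :
    VectorField (CovE n m₀ k₀) (CovO n m₁ k₁)
  | Sum.inl (Sum.inl j) => H (Sum.inl j)
  | Sum.inl (Sum.inr p) => V (Sum.inl p)
  | Sum.inr (Sum.inl j) => H (Sum.inr j)
  | Sum.inr (Sum.inr q) => V (Sum.inr q)

/-- The coefficients along `W` of `∑_k q^k ϱ(e_k)`. -/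
def vertCoef (b : 𝔤.HomBasis r) (ϱ : 𝔤.VectRep) (q : Fin r → JetFun n m₀ m₁)
    (j : Fin k₀ ⊕ Fin k₁) : SuperFun (CovE n m₀ k₀) (CovO n m₁ k₁) :=
  ∑ k, fromJet (q k) * fromW (ϱ.map (b.e k) j)

theorem parityAut_pull {E O E' O' : Type} (e : E → E') (o : O → O') (f : SuperFun E O) :
    parityAut (pull e o f) = pull e o (parityAut f) := by
  have h : ∀ w : Grassmann O, CliffordAlgebra.involute
      (ExteriorAlgebra.map (Finsupp.lmapDomain ℂ ℂ o) w) =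
      ExteriorAlgebra.map (Finsupp.lmapDomain ℂ ℂ o) (CliffordAlgebra.involute w) := by
    intro w
    induction w using CliffordAlgebra.left_induction with
    | algebraMap r => simp only [AlgHom.commutes]
    | add x y hx hy => simp only [map_add, hx, hy]
    | ι_mul x m hx =>
      have h1 : ExteriorAlgebra.map (Finsupp.lmapDomain ℂ ℂ o) (CliffordAlgebra.ι _ m) =
        CliffordAlgebra.ι _ (Finsupp.lmapDomain ℂ ℂ o m) := ExteriorAlgebra.map_apply_ι _ _
      simp only [map_mul, hx, h1, CliffordAlgebra.involute_ι, map_neg]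
  induction f using SuperFun.induction with
  | zero => simp only [map_zero]
  | tmul g w => exact congrArg (fun v => SuperFun.tmul _ v) (h w)
  | add x y hx hy => simp only [map_add, hx, hy]

theorem HasParity.pull {E O E' O' : Type} (e : E → E') (o : O → O') {p : ZMod 2}
    {f : SuperFun E O} (h : HasParity p f) : HasParity p (SuperPDE.pull e o f) := by
  unfold HasParity at *
  rw [parityAut_pull, h, map_smul]

theorem HasParity.mul {E O : Type} {p q : ZMod 2} {f g : SuperFun E O}
    (hf : HasParity p f) (hg : HasParity q g) : HasParity (p + q) (f * g) := by
  unfold HasParity at *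
  rw [map_mul, hf, hg, smul_mul_smul_comm]
  have h2 : ∀ x : ZMod 2, x = 0 ∨ x = 1 := by decide
  have h0 : (0 : ZMod 2) ≠ 1 := by decide
  have h3 : (1 : ZMod 2) + 1 = 0 := by decide
  congr 1
  rcases h2 p with rfl | rfl <;> rcases h2 q with rfl | rfl <;> simp [sgn, h3]

theorem HasParity.zero {E O : Type} (p : ZMod 2) : HasParity p (0 : SuperFun E O) := by
  simp [HasParity]

theorem HasParity.sum {E O ι : Type} {p : ZMod 2} (s : Finset ι) {f : ι → SuperFun E O}
    (h : ∀ i, HasParity p (f i)) : HasParity p (∑ i ∈ s, f i) := by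
  unfold HasParity at *
  rw [map_sum, Finset.smul_sum]
  exact Finset.sum_congr rfl fun i _ => h i

theorem vertCoef_hasParity (b : 𝔤.HomBasis r) (ϱ : 𝔤.VectRep) (q : GFun n m₀ m₁ b)
    (j : Fin k₀ ⊕ Fin k₁) : HasParity (par j) (vertCoef b ϱ q.coef j) := by
  refine HasParity.sum _ fun k => ?_
  have h := ((q.even k).pull (Sum.inl : _ → CovE n m₀ k₀) (Sum.inl : _ → CovO n m₁ k₁)).mul
    ((ϱ.parity _ _ (b.homogeneous k) j).pull (Sum.inr : _ → CovE n m₀ k₀)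
      (Sum.inr : _ → CovO n m₁ k₁))
  rwa [← add_assoc, CharTwo.add_self_eq_zero, zero_add] at h

/-- The vector field `X = ∑_k q^k ϱ(e_k)` on the covering. -/
def gField (b : 𝔤.HomBasis r) (ϱ : 𝔤.VectRep) (q : GFun n m₀ m₁ b) :
    EvenField (CovE n m₀ k₀) (CovO n m₁ k₁) where
  coef := combine (fun _ => 0) (vertCoef b ϱ q.coef)
  even := by
    rintro ((j | p) | (j | p)) <;> rw [zero_add]
    · exact HasParity.zero _
    · exact vertCoef_hasParity b ϱ q (Sum.inl p)
    · exact HasParity.zero _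
    · exact vertCoef_hasParity b ϱ q (Sum.inr p)

/-- The prolonged total derivatives of the covering determined by `α = ∑_i dx^i a_i^k e_k`:
`D_{x^i}` plus the vertical field for which `w_{x^i} = - a_i^k ϱ(e_k) ⌟ dw` and
`f_{x^i} = - a_i^k ϱ(e_k) ⌟ df`. -/
def prolongedD (b : 𝔤.HomBasis r) (ϱ : 𝔤.VectRep) (a : Fin n → GFun n m₀ m₁ b) (i : Fin n) :
    VectorField (CovE n m₀ k₀) (CovO n m₁ k₁) :=
  combine (fun j => fromJet (totalD i j)) (fun j => -vertCoef b ϱ (a i).coef j)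

/-- The characteristic element of the covering: the connection form
`U(f) = df - ∑_i dx^i D_i(f)` of the connection spanned by the prolonged total derivatives `D_i`.
In coordinates, `U = ∑_j (dz^j - ∑_i dx^i D_i(z^j)) ∂/∂z^j`, where the terms with `z^j = x^i`
are zero. -/
def charElement (D : Fin n → VectorField (CovE n m₀ k₀) (CovO n m₁ k₁)) :
    SuperFun (CovE n m₀ k₀) (CovO n m₁ k₁) → Form1 (CovE n m₀ k₀) (CovO n m₁ k₁) :=
  fun f => d0 f - ∑ i, Finsupp.single (Sum.inl (Sum.inl (Sum.inl i))) ((D i).apply f)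

/-- The function on the product of the jet space and `W` vanishes on the covering equation
`𝓔^∞ × W`. -/
def PDESystem.CovVanishes (𝓔 : PDESystem n m₀ m₁)
    (f : SuperFun (CovE n m₀ k₀) (CovO n m₁ k₁)) : Prop :=
  f ∈ TwoSidedIdeal.span {h | ∃ g, 𝓔.Consequence g ∧ h = fromJet g}

/-- The one-form on the product of the jet space and `W` vanishes when restricted to the covering
equation `𝓔^∞ × W`: it is a sum of forms `dz^j f` and `(df) h`, where the functions `f` vanish on
the covering equation. -/
def PDESystem.FormVanishes (𝓔 : PDESystem n m₀ m₁)
    (η : Form1 (CovE n m₀ k₀) (CovO n m₁ k₁)) : Prop :=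
  η ∈ Submodule.span ℂ
    ({θ | ∃ j f, 𝓔.CovVanishes f ∧ θ = Finsupp.single j f} ∪
      {θ | ∃ f h, 𝓔.CovVanishes f ∧ θ = (d0 f).mulRight h})

/-- `dU/dλ = V` on the covering equation, for families `U` and `V` (with parameter `λ` in `I`) of
derivations from functions to one-forms: for every function `f` the family `U_λ(f)` is
smooth, and its derivative at every `λ` in `I` coincides with `V_λ(f)` on the covering equation. -/
def PDESystem.HasParamDerivOn (𝓔 : PDESystem n m₀ m₁) (I : Set ℂ)
    (U V : ℂ → SuperFun (CovE n m₀ k₀) (CovO n m₁ k₁) → Form1 (CovE n m₀ k₀) (CovO n m₁ k₁)) :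
    Prop :=
  ∀ f, ∃ U' : ℂ → Form1 (CovE n m₀ k₀) (CovO n m₁ k₁),
    HasParamDerivForm I (fun l => U l f) U' ∧ ∀ l ∈ I, 𝓔.FormVanishes (U' l - V l f)

end Covering

end SuperPDE

end

/-! Everything reduces to one identity between vertical vector fields, which holds identically on
the product of the jet space with `W`; the equation enters only at the end, as membership in an
ideal.

The Lie derivative along X = q^k ϱ(e_k) commutes with d because d² = 0 (`d1_d0`), and it kills every
dx^i because X is vertical. Hence the terms d(X f) cancel and [X, U](f) = ∑ dx^i [D_i, X](f), where
the D_i are the prolonged total derivatives (`fnBracket_charElement`). To compute [D_i, X], note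
that X annihilates functions on the jet space, that D_i acts on them as the total derivative, and
that the vertical parts combine through the bracket relation of ϱ. The result is [D_i, X] = (D_{x^i}
q - [a_i, q])^p ϱ(e_p) (`bracket_prolongedD_gField`). Even fields are derivations without signs, so
signs arise only from exchanging homogeneous coefficients.

On the other side, λ enters U only through the coefficients a, linearly, so dU/dλ (f) = ∑ dx^i
(a'_i)^p ϱ(e_p)(f) (`hasParamDerivForm_charElement`). It remains to show that the coefficients of a'
- D q + [a, q] vanish on the equation. The matrix hypothesis says this after applying ρ: by
`evenBracket_gMatrix` the matrix bracket has the same coefficients `bracketCoef`, and faithfulness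
of ρ recovers each coefficient as a complex combination of matrix entries (`vanishes_of_gMatrix`).
Pulling the ideal back to the covering finishes the argument (`covVanishes_apply`). -/

namespace SuperPDE

open scoped TensorProduct ContDiff

/-! ### Sign rules and odd derivatives in the Grassmann algebra. -/

section GrassmannAlgebra

variable {O : Type}

/-- The parity automorphism of the Grassmann algebra. -/
noncomputable abbrev gInv : Grassmann O →ₐ[ℂ] Grassmann O :=
  CliffordAlgebra.involute (Q := (0 : QuadraticForm ℂ (O →₀ ℂ)))

theorem grassmann_ι_mul (m : O →₀ ℂ) (y : Grassmann O) :
    CliffordAlgebra.ι (0 : QuadraticForm ℂ (O →₀ ℂ)) m * y =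
      gInv y * CliffordAlgebra.ι (0 : QuadraticForm ℂ (O →₀ ℂ)) m := by
  induction y using CliffordAlgebra.left_induction with
  | algebraMap r => rw [AlgHom.commutes, Algebra.commutes]
  | add x y hx hy => rw [mul_add, map_add, add_mul, hx, hy]
  | ι_mul x v hx =>
    have h : CliffordAlgebra.ι (0 : QuadraticForm ℂ (O →₀ ℂ)) m * CliffordAlgebra.ι _ v =
        -(CliffordAlgebra.ι _ v * CliffordAlgebra.ι _ m) :=
      eq_neg_of_add_eq_zero_left (ExteriorAlgebra.ι_add_mul_swap m v)
    rw [← mul_assoc, h, map_mul, CliffordAlgebra.involute_ι, neg_mul, mul_assoc, hx, neg_mul,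
      neg_mul, mul_assoc]

/-- Supercommutativity without homogeneity assumptions: `y + gInv y` and `y - gInv y` are twice the
even and odd parts of `y`. The even part commutes with `x`, and the odd part passes it at the cost
of `gInv`. The formula is linear in `x`, so it can be proved one generator at a time. -/
theorem grassmann_mul_comm (x y : Grassmann O) :
    (2 : ℂ) • (x * y) = (y + gInv y) * x + (y - gInv y) * gInv x := by
  induction x using CliffordAlgebra.left_induction with
  | algebraMap r =>
    rw [AlgHom.commutes, ← add_mul, Algebra.commutes r, two_smul, ← add_mul]
    congr 1
    abel
  | add x z hx hz => rw [add_mul, smul_add, hx, hz, map_add]; noncomm_ring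
  | ι_mul x m hx =>
    have h1 := grassmann_ι_mul m y
    have h2 := grassmann_ι_mul m (gInv y)
    rw [show gInv (gInv y) = y from CliffordAlgebra.involute_involute y] at h2
    rw [mul_assoc, ← mul_smul_comm, hx, map_mul, CliffordAlgebra.involute_ι, mul_add, ← mul_assoc,
      ← mul_assoc, mul_add, mul_sub, h1, h2]
    noncomm_ring

/-- Each generator of `x` that the derivative passes contributes a sign; together these signs form
`gInv x`. -/
theorem pderivOdd_mul (o : O) (x y : Grassmann O) :
    pderivOdd o (x * y) = pderivOdd o x * y + gInv x * pderivOdd o y := by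
  unfold pderivOdd
  induction x using CliffordAlgebra.left_induction with
  | algebraMap r =>
    rw [AlgHom.commutes, CliffordAlgebra.contractLeft_algebraMap, zero_mul, zero_add,
      CliffordAlgebra.contractLeft_algebraMap_mul]
  | add x z hx hz => rw [add_mul, map_add, hx, hz, map_add, map_add]; noncomm_ring
  | ι_mul x m hx =>
    rw [mul_assoc, CliffordAlgebra.contractLeft_ι_mul, CliffordAlgebra.contractLeft_ι_mul, hx,
      map_mul, CliffordAlgebra.involute_ι, sub_mul, smul_mul_assoc, mul_add, neg_mul, neg_mul,
      ← mul_assoc, ← mul_assoc]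
    abel

theorem pderivOdd_comm (o o' : O) (x : Grassmann O) :
    pderivOdd o (pderivOdd o' x) = -pderivOdd o' (pderivOdd o x) :=
  CliffordAlgebra.contractLeft_comm _ _ _

theorem pderivOdd_map {O' : Type} (f : O → O') (hf : Function.Injective f) (o : O)
    (x : Grassmann O) :
    pderivOdd (f o) (ExteriorAlgebra.map (Finsupp.lmapDomain ℂ ℂ f) x) =
      ExteriorAlgebra.map (Finsupp.lmapDomain ℂ ℂ f) (pderivOdd o x) := by
  unfold pderivOdd
  induction x using CliffordAlgebra.left_induction with
  | algebraMap r =>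
    rw [AlgHom.commutes, CliffordAlgebra.contractLeft_algebraMap,
      CliffordAlgebra.contractLeft_algebraMap, map_zero]
  | add x z hx hz => simp only [map_add, hx, hz]
  | ι_mul x m hx =>
    have h1 : ExteriorAlgebra.map (Finsupp.lmapDomain ℂ ℂ f) (CliffordAlgebra.ι _ m) =
      CliffordAlgebra.ι _ (Finsupp.lmapDomain ℂ ℂ f m) := ExteriorAlgebra.map_apply_ι _ _
    rw [CliffordAlgebra.contractLeft_ι_mul, map_mul (ExteriorAlgebra.map _), map_sub,
      map_mul (ExteriorAlgebra.map _), map_smul, h1, CliffordAlgebra.contractLeft_ι_mul, hx]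
    congr 2
    exact Finsupp.mapDomain_apply hf m o

theorem pderivOdd_map_of_notMem {O' : Type} (f : O → O') {o : O'} (ho : o ∉ Set.range f)
    (x : Grassmann O) :
    pderivOdd o (ExteriorAlgebra.map (Finsupp.lmapDomain ℂ ℂ f) x) = 0 := by
  unfold pderivOdd
  induction x using CliffordAlgebra.left_induction with
  | algebraMap r => rw [AlgHom.commutes, CliffordAlgebra.contractLeft_algebraMap]
  | add x z hx hz => simp only [map_add, hx, hz, add_zero]
  | ι_mul x m hx =>
    have h1 : ExteriorAlgebra.map (Finsupp.lmapDomain ℂ ℂ f) (CliffordAlgebra.ι _ m) =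
      CliffordAlgebra.ι _ (Finsupp.lmapDomain ℂ ℂ f m) := ExteriorAlgebra.map_apply_ι _ _
    rw [map_mul, h1, CliffordAlgebra.contractLeft_ι_mul, hx, mul_zero, sub_zero]
    have : Finsupp.lapply (R := ℂ) o (Finsupp.lmapDomain ℂ ℂ f m) = 0 :=
      Finsupp.mapDomain_of_notMem_range m o ho
    rw [this, zero_smul]

end GrassmannAlgebra

/-! ### Even partial derivatives of smooth functions. -/

section SmoothFunctions

variable {E : Type}

theorem pderivEven_mul [DecidableEq E] (e : E) (f g : SmoothFun E) :
    pderivEven e (f * g) = pderivEven e f * g + f * pderivEven e g := by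
  ext p
  obtain ⟨S, φ, hφ, hf⟩ := f.2
  obtain ⟨T, ψ, hψ, hg⟩ := g.2
  have h := ((SmoothFun.hasDerivAt hφ hf e p).differentiableAt.hasDerivAt.mul
      (SmoothFun.hasDerivAt hψ hg e p).differentiableAt.hasDerivAt).deriv
  simp only [Function.update_eq_self] at h
  exact h

/-- Since `f` factors through finitely many coordinates, both sides are values of the second Fréchet
derivative of one smooth function on a finite-dimensional space, and that derivative is symmetric.
-/
theorem pderivEven_comm [DecidableEq E] (e e' : E) (f : SmoothFun E) :
    pderivEven e (pderivEven e' f) = pderivEven e' (pderivEven e f) := by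
  obtain ⟨S, φ, hφ, hf⟩ := f.2
  let v : E → S → ℝ := fun e s => if (s : E) = e then 1 else 0
  have h1 : ∀ e p, (pderivEven e f).1 p = fderiv ℝ φ (fun s => p s) (v e) := fun e p =>
    (SmoothFun.hasDerivAt hφ hf e p).deriv
  have h2 : ∀ e, ContDiff ℝ ∞ (fun y => fderiv ℝ φ y (v e)) := fun e =>
    (hφ.fderiv_right (m := ∞) (by simp)).clm_apply contDiff_const
  have h3 : ∀ y, DifferentiableAt ℝ (fderiv ℝ φ) y := fun y =>
    (hφ.fderiv_right (m := ∞) (by simp)).differentiable (by simp) y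
  have h4 : ∀ e e' p, (pderivEven e (pderivEven e' f)).1 p =
      fderiv ℝ (fderiv ℝ φ) (fun s => p s) (v e) (v e') := fun e e' p => by
    refine (SmoothFun.hasDerivAt (h2 e') (h1 e') e p).deriv.trans ?_
    rw [fderiv_clm_apply (h3 _) (differentiableAt_const _)]
    simp [v]
  ext p
  rw [h4, h4]
  exact (hφ.contDiffAt.isSymmSndFDerivAt (by simpa using ENat.LEInfty.out)) _ _

end SmoothFunctions

/-! ### Supercommutativity and differential calculus of superfunctions. -/

section Super

variable {E O : Type}

theorem SuperFun.tmul_mul_tmul (f g : SmoothFun E) (v w : Grassmann O) :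
    SuperFun.tmul f v * SuperFun.tmul g w = SuperFun.tmul (f * g) (v * w) :=
  Algebra.TensorProduct.tmul_mul_tmul f g v w

theorem SuperFun.tmul_add (f : SmoothFun E) (v w : Grassmann O) :
    SuperFun.tmul f (v + w) = SuperFun.tmul f v + SuperFun.tmul f w :=
  TensorProduct.tmul_add f v w

theorem SuperFun.add_tmul (f g : SmoothFun E) (w : Grassmann O) :
    SuperFun.tmul (f + g) w = SuperFun.tmul f w + SuperFun.tmul g w :=
  TensorProduct.add_tmul f g w

theorem SuperFun.tmul_smul (c : ℂ) (f : SmoothFun E) (w : Grassmann O) :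
    SuperFun.tmul f (c • w) = c • SuperFun.tmul f w :=
  TensorProduct.tmul_smul c f w

theorem parityAut_tmul (f : SmoothFun E) (w : Grassmann O) :
    parityAut (SuperFun.tmul f w) = SuperFun.tmul f (gInv w) := rfl

theorem pderiv_inl_tmul [DecidableEq E] (e : E) (f : SmoothFun E) (w : Grassmann O) :
    pderiv (Sum.inl e) (SuperFun.tmul f w) = SuperFun.tmul (pderivEven e f) w := rfl

theorem pderiv_inr_tmul [DecidableEq E] (o : O) (f : SmoothFun E) (w : Grassmann O) :
    pderiv (Sum.inr o) (SuperFun.tmul f w) = SuperFun.tmul f (pderivOdd o w) := rfl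

/-- The smooth factors commute and parity acts on the Grassmann factor alone, so bilinearity reduces
this to `grassmann_mul_comm`. -/
theorem superFun_mul_comm (f g : SuperFun E O) :
    (2 : ℂ) • (f * g) = (g + parityAut g) * f + (g - parityAut g) * parityAut f := by
  induction f using SuperFun.induction with
  | zero => simp only [zero_mul, mul_zero, map_zero, smul_zero, add_zero]
  | add x y hx hy => rw [add_mul, smul_add, hx, hy, map_add]; noncomm_ring
  | tmul f v =>
    induction g using SuperFun.induction with
    | zero => simp only [zero_mul, mul_zero, map_zero, smul_zero, add_zero, sub_zero]
    | add x y hx hy => rw [mul_add, smul_add, hx, hy, map_add]; noncomm_ring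
    | tmul g w =>
      have h : SuperFun.tmul g w - SuperFun.tmul g (gInv w) = SuperFun.tmul g (w - gInv w) :=
        (TensorProduct.tmul_sub g w (gInv w)).symm
      rw [parityAut_tmul, parityAut_tmul, ← SuperFun.tmul_add, h]
      simp only [SuperFun.tmul_mul_tmul]
      rw [← SuperFun.tmul_add, ← SuperFun.tmul_smul, grassmann_mul_comm, mul_comm f g]

theorem zmod_two_cases (p : ZMod 2) : p = 0 ∨ p = 1 := by
  revert p; decide

theorem twist_zero (f : SuperFun E O) : twist 0 f = f := by simp [twist]

theorem twist_one (f : SuperFun E O) : twist 1 f = parityAut f := by simp [twist]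

theorem sgn_zero_left (p : ZMod 2) : sgn 0 p = 1 := by simp [sgn]

theorem sgn_zero_right (p : ZMod 2) : sgn p 0 = 1 := by simp [sgn]

theorem sgn_one_one : sgn 1 1 = -1 := by simp [sgn]

theorem sgn_comm (p q : ZMod 2) : sgn p q = sgn q p := by simp [sgn, and_comm]

theorem sgn_mul_self (p q : ZMod 2) : sgn p q * sgn p q = 1 := by
  unfold sgn; split_ifs <;> norm_num

/-- Homogeneous functions supercommute with all functions. -/
theorem HasParity.mul_comm {p : ZMod 2} {g : SuperFun E O} (hg : HasParity p g)
    (f : SuperFun E O) : f * g = g * twist p f := by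
  -- For homogeneous `g`, one of `g + parityAut g` and `g - parityAut g` is zero and the other is `2
  -- g`; the factor 2 then cancels.
  have h := superFun_mul_comm f g
  have h2 : (2 : ℂ) ≠ 0 := two_ne_zero
  rw [← smul_right_inj h2, h]
  unfold HasParity at hg
  rcases zmod_two_cases p with rfl | rfl
  · rw [hg, sgn_zero_right, one_smul, twist_zero, sub_self, zero_mul, add_zero, two_smul, add_mul]
  · rw [hg, sgn_one_one, neg_one_smul, twist_one, add_neg_cancel, zero_mul, zero_add,
      sub_neg_eq_add, two_smul, add_mul]

theorem HasParity.mul_comm_sgn {p q : ZMod 2} {f g : SuperFun E O} (hf : HasParity p f)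
    (hg : HasParity q g) : f * g = sgn p q • (g * f) := by
  rw [hg.mul_comm, twist_of_hasParity hf, mul_smul_comm, sgn_comm]

theorem HasParity.neg {p : ZMod 2} {f : SuperFun E O} (hf : HasParity p f) :
    HasParity p (-f) := by
  unfold HasParity at *
  rw [map_neg, hf, smul_neg]

theorem HasParity.one : HasParity 0 (1 : SuperFun E O) := by
  unfold HasParity
  rw [map_one, sgn_zero_right, one_smul]

theorem hasParity_coord (j : E ⊕ O) : HasParity (par j) (coord j) := by
  unfold HasParity
  rcases j with e | o
  · rw [par, sgn_zero_right, one_smul]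
    exact congrArg (SuperFun.tmul _) (map_one gInv)
  · rw [par, sgn_one_one, neg_one_smul]
    refine (congrArg (SuperFun.tmul _) (CliffordAlgebra.involute_ι _)).trans ?_
    exact TensorProduct.tmul_neg _ _

/-- The Leibniz rule for partial derivatives. -/
theorem pderiv_mul [DecidableEq E] (j : E ⊕ O) (f g : SuperFun E O) :
    pderiv j (f * g) = pderiv j f * g + twist (par j) f * pderiv j g := by
  induction f using SuperFun.induction with
  | zero => simp only [zero_mul, map_zero, add_zero]
  | add x y hx hy => rw [add_mul, map_add, hx, hy, map_add, map_add]; noncomm_ring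
  | tmul f v =>
    induction g using SuperFun.induction with
    | zero => simp only [mul_zero, map_zero, add_zero]
    | add x y hx hy => rw [mul_add, map_add, hx, hy, map_add]; noncomm_ring
    | tmul g w =>
      rcases j with e | o
      · simp only [par, twist_zero, SuperFun.tmul_mul_tmul, pderiv_inl_tmul, pderivEven_mul,
          SuperFun.add_tmul]
      · simp only [par, twist_one, parityAut_tmul, SuperFun.tmul_mul_tmul, pderiv_inr_tmul,
          pderivOdd_mul, SuperFun.tmul_add]

theorem pderiv_comm [DecidableEq E] (j k : E ⊕ O) (f : SuperFun E O) :
    pderiv j (pderiv k f) = sgn (par j) (par k) • pderiv k (pderiv j f) := by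
  induction f using SuperFun.induction with
  | zero => simp only [map_zero, smul_zero]
  | add x y hx hy => simp only [map_add, hx, hy, smul_add]
  | tmul f w =>
    rcases j with e | o <;> rcases k with e' | o'
    · simp only [par, sgn_zero_left, one_smul, pderiv_inl_tmul, pderivEven_comm e]
    · simp only [par, sgn_zero_left, one_smul, pderiv_inl_tmul, pderiv_inr_tmul]
    · simp only [par, sgn_zero_right, one_smul, pderiv_inl_tmul, pderiv_inr_tmul]
    · simp only [par, sgn_one_one, pderiv_inr_tmul]
      rw [pderivOdd_comm, ← neg_one_smul ℂ (pderivOdd o' _), SuperFun.tmul_smul]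

/-! ### The action of vector fields on functions -/

theorem VectorField.apply_eq_sum [DecidableEq E] (X : VectorField E O) (f : SuperFun E O)
    {S : Finset (E ⊕ O)} (hS : ∀ j, pderiv j f ≠ 0 → j ∈ S) :
    X.apply f = ∑ j ∈ S, X j * pderiv j f :=
  Finsupp.sum_of_support_subset (d0 f) (fun j hj => hS j (Finsupp.mem_support_iff.1 hj)) _
    fun _ _ => mul_zero _

/-- The action of a vector field on functions, as a linear map. -/
noncomputable def VectorField.applyLin [DecidableEq E] (X : VectorField E O) :
    SuperFun E O →ₗ[ℂ] SuperFun E O :=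
  (Finsupp.lsum ℂ fun j => LinearMap.mulLeft ℂ (X j)).comp d0

theorem VectorField.applyLin_apply [DecidableEq E] (X : VectorField E O) (f : SuperFun E O) :
    X.applyLin f = X.apply f := rfl

/-- A common finite index set lets the sums defining the action of fields on several functions be
compared term by term. -/
theorem exists_pderiv_support [DecidableEq E] (s : Finset (SuperFun E O)) :
    ∃ S : Finset (E ⊕ O), ∀ f ∈ s, ∀ j, pderiv j f ≠ 0 → j ∈ S := by
  classical
  exact ⟨s.biUnion fun f => (pderiv_finite f).toFinset, fun f hf j hj =>
    Finset.mem_biUnion.2 ⟨f, hf, by simpa using hj⟩⟩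

/-- Even vector fields are derivations. -/
theorem VectorField.HasParity.apply_mul [DecidableEq E] {X : VectorField E O} (hX : X.HasParity 0)
    (f g : SuperFun E O) : X.apply (f * g) = X.apply f * g + f * X.apply g := by
  classical
  obtain ⟨S, hS⟩ := exists_pderiv_support {f, g, f * g}
  simp only [Finset.mem_insert, Finset.mem_singleton, forall_eq_or_imp, forall_eq] at hS
  rw [X.apply_eq_sum f hS.1, X.apply_eq_sum g hS.2.1, X.apply_eq_sum (f * g) hS.2.2,
    Finset.sum_mul, Finset.mul_sum, ← Finset.sum_add_distrib]
  refine Finset.sum_congr rfl fun j _ => ?_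
  -- For an even field, `X j` has the parity of `z^j`, so moving `f` across it produces exactly the
  -- twist in the Leibniz rule for the `j`-th partial derivative.
  have h : f * X j = X j * twist (par j) f :=
    SuperPDE.HasParity.mul_comm (by have := hX j; rwa [zero_add] at this) f
  rw [pderiv_mul, mul_add, ← mul_assoc, ← mul_assoc, ← mul_assoc, h]

/-- The commutator of even vector fields, as operators on functions, is given by their bracket. -/
theorem VectorField.bracket_apply [DecidableEq E] {X Y : VectorField E O} (hX : X.HasParity 0)
    (hY : Y.HasParity 0) (f : SuperFun E O) :
    (VectorField.bracket 0 0 X Y).apply f = X.apply (Y.apply f) - Y.apply (X.apply f) := by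
  obtain ⟨S, hS⟩ := exists_pderiv_support {f}
  simp only [Finset.mem_singleton, forall_eq] at hS
  -- Partial derivatives supercommute, so the index set of the first derivatives also serves the
  -- second ones.
  have hS' : ∀ j k, pderiv k (pderiv j f) ≠ 0 → k ∈ S := fun j k h => hS k fun h0 => h (by
    rw [pderiv_comm, h0, map_zero, smul_zero])
  have key : ∀ {X Y : VectorField E O}, X.HasParity 0 → X.apply (Y.apply f) =
      ∑ j ∈ S, X.apply (Y j) * pderiv j f +
        ∑ j ∈ S, ∑ k ∈ S, Y j * (X k * pderiv k (pderiv j f)) := by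
    intro X Y hX
    rw [Y.apply_eq_sum f hS, ← X.applyLin_apply, map_sum, ← Finset.sum_add_distrib]
    refine Finset.sum_congr rfl fun j _ => ?_
    rw [applyLin_apply, hX.apply_mul, X.apply_eq_sum _ (hS' j), Finset.mul_sum]
  rw [key hX, key hY, VectorField.apply_eq_sum _ f hS, Finset.sum_comm (γ := E ⊕ O)
    (f := fun j k => X j * (Y k * pderiv k (pderiv j f)))]
  -- The second-order terms cancel: exchanging the coefficients and exchanging the derivatives give
  -- the same sign, whose square is 1.
  have : ∀ j k, X k * (Y j * pderiv j (pderiv k f)) = Y j * (X k * pderiv k (pderiv j f)) := by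
    intro j k
    have h1 := hX k
    have h2 := hY j
    rw [zero_add] at h1 h2
    rw [← mul_assoc, h1.mul_comm_sgn h2, pderiv_comm, smul_mul_smul_comm, sgn_comm, sgn_mul_self,
      one_smul, mul_assoc]
  simp only [this, VectorField.bracket, sgn_zero_left, one_smul, sub_mul, Finset.sum_sub_distrib]
  abel

/-- The de Rham differential squares to zero. -/
theorem d1_d0 [DecidableEq E] (f : SuperFun E O) : d1 (d0 f) = 0 := by
  obtain ⟨S, hS⟩ := exists_pderiv_support {f}
  simp only [Finset.mem_singleton, forall_eq] at hS
  have hS' : ∀ j k, pderiv k (pderiv j f) ≠ 0 → k ∈ S := fun j k h => hS k fun h0 => h (by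
    rw [pderiv_comm, h0, map_zero, smul_zero])
  have hd : ∀ g : SuperFun E O, (∀ j, pderiv j g ≠ 0 → j ∈ S) →
      d0 g = ∑ k ∈ S, Finsupp.single k (pderiv k g) := fun g hg => by
    ext j
    rw [Finsupp.finsetSum_apply]
    by_cases hj : pderiv j g = 0
    · rw [Finset.sum_eq_zero]
      · exact hj
      · intro k _
        by_cases hk : k = j
        · rw [hk, hj, Finsupp.single_zero]; rfl
        · rw [Finsupp.single_eq_of_ne (Ne.symm hk)]
    · rw [Finset.sum_eq_single_of_mem j (hg j hj)]
      · rw [Finsupp.single_eq_same]; rfl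
      · intro k _ hk
        rw [Finsupp.single_eq_of_ne (Ne.symm hk)]
  let c : (E ⊕ O) → (E ⊕ O) → (((E ⊕ O) × (E ⊕ O)) →₀ SuperFun E O) := fun j k =>
    Finsupp.single (j, k) (pderiv k (pderiv j f))
  have h1 : d1 (d0 f) = -(wedgeRel E O).mkQ (∑ j ∈ S, ∑ k ∈ S, c j k) := by
    rw [hd f hS, map_sum, map_sum, ← Finset.sum_neg_distrib]
    refine Finset.sum_congr rfl fun j _ => ?_
    rw [d1, LinearMap.comp_apply, Finsupp.lsum_single, LinearMap.neg_apply, map_neg,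
      LinearMap.comp_apply, hd _ (hS' j), map_sum]
    simp only [Finsupp.lmapDomain_apply, Finsupp.mapDomain_single, c]
  rw [h1, neg_eq_zero, Submodule.mkQ_apply, Submodule.Quotient.mk_eq_zero]
  -- Doubling symmetrizes the sum, and each symmetrized term is a wedge relation because the second
  -- derivatives supercommute. As 2 is invertible, the sum itself lies in the relations.
  have h2 : (2 : ℂ) • ∑ j ∈ S, ∑ k ∈ S, c j k = ∑ j ∈ S, ∑ k ∈ S, (c j k + c k j) := by
    simp only [Finset.sum_add_distrib]
    rw [Finset.sum_comm (f := fun j k => c k j), two_smul]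
  have h3 : (2 : ℂ) • ∑ j ∈ S, ∑ k ∈ S, c j k ∈ wedgeRel E O := by
    rw [h2]
    refine Submodule.sum_mem _ fun j _ => Submodule.sum_mem _ fun k _ => Submodule.subset_span ?_
    refine ⟨j, k, pderiv k (pderiv j f), ?_⟩
    simp only [c]
    rw [pderiv_comm j k, Finsupp.smul_single]
  exact (Submodule.smul_mem_iff _ (two_ne_zero)).1 h3

/-! ### Partial derivatives of pull-backs -/

variable {E' O' : Type}

/-- Injectivity of `e` ensures that varying the coordinate `e i` moves only the `i`-th argument of
`f`. -/
theorem pderivEven_comp [DecidableEq E] [DecidableEq E'] {e : E → E'} (he : Function.Injective e)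
    (i : E) {f : SmoothFun E} {g : SmoothFun E'} (h : ∀ p, g.1 p = f.1 fun i => p (e i))
    (p : E' → ℝ) : (pderivEven (e i) g).1 p = (pderivEven i f).1 fun i => p (e i) := by
  change deriv _ _ = deriv _ _
  congr 1
  funext t
  rw [h]
  refine congrArg f.1 (funext fun k => ?_)
  by_cases hk : k = i
  · subst hk; simp
  · rw [Function.update_of_ne hk, Function.update_of_ne (he.ne hk)]

theorem pderiv_pull [DecidableEq E] [DecidableEq E'] {e : E → E'} (he : Function.Injective e)
    {o : O → O'} (ho : Function.Injective o) (j : E ⊕ O) (f : SuperFun E O) :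
    pderiv (Sum.map e o j) (pull e o f) = pull e o (pderiv j f) := by
  induction f using SuperFun.induction with
  | zero => simp only [map_zero]
  | add x y hx hy => simp only [map_add, hx, hy]
  | tmul f w =>
    rcases j with i | i
    · refine congrArg (fun h => SuperFun.tmul h _) ?_
      ext p
      exact pderivEven_comp he i (fun _ => rfl) p
    · exact congrArg (SuperFun.tmul _) (pderivOdd_map o ho i w)

theorem pderiv_pull_of_notMem [DecidableEq E'] (e : E → E') (o : O → O') {j : E' ⊕ O'}
    (hj : j ∉ Set.range (Sum.map e o)) (f : SuperFun E O) : pderiv j (pull e o f) = 0 := by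
  induction f using SuperFun.induction with
  | zero => simp only [map_zero]
  | add x y hx hy => simp only [map_add, hx, hy, add_zero]
  | tmul f w =>
    rcases j with i | i
    · refine Eq.trans (congrArg (fun h => SuperFun.tmul h _) ?_) (TensorProduct.zero_tmul _ _)
      ext p
      change deriv _ _ = 0
      refine Eq.trans (congrArg (fun F => deriv F (p i)) (funext fun t => ?_))
        (deriv_const (p i) (f.1 fun k => p (e k)))
      refine congrArg f.1 (funext fun k => ?_)
      exact Function.update_of_ne (fun h => hj ⟨Sum.inl k, by simp [h]⟩) _ _
    · refine Eq.trans (congrArg (SuperFun.tmul _) ?_) (TensorProduct.tmul_zero _ _)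
      exact pderivOdd_map_of_notMem o (fun ⟨k, hk⟩ => hj ⟨Sum.inr k, by simp [hk]⟩) w

/-- The action of a vector field on a function that is pulled back from fewer coordinates. -/
theorem VectorField.apply_pull [DecidableEq E] [DecidableEq E'] {e : E → E'}
    (he : Function.Injective e) {o : O → O'} (ho : Function.Injective o)
    (X : VectorField E' O') (f : SuperFun E O) {S : Finset (E ⊕ O)}
    (hS : ∀ j, pderiv j f ≠ 0 → j ∈ S) :
    X.apply (pull e o f) = ∑ j ∈ S, X (Sum.map e o j) * pull e o (pderiv j f) := by
  classical
  rw [X.apply_eq_sum (pull e o f) (S := S.image (Sum.map e o)), Finset.sum_image]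
  · exact Finset.sum_congr rfl fun j _ => by rw [pderiv_pull he ho]
  · exact fun j _ k _ h => Sum.map_injective.2 ⟨he, ho⟩ h
  · intro j hj
    by_cases h : j ∈ Set.range (Sum.map e o)
    · obtain ⟨k, rfl⟩ := h
      rw [pderiv_pull he ho] at hj
      exact Finset.mem_image_of_mem _ (hS k fun h0 => hj (by rw [h0, map_zero]))
    · exact absurd (pderiv_pull_of_notMem e o h f) hj

end Super
-- Closure properties of parameter-dependent families.
section ParamDeriv

variable {E O : Type} {I : Set ℂ}

theorem HasParamDerivSmooth.const (f : SmoothFun E) :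
    HasParamDerivSmooth I (fun _ => f) (fun _ => 0) := by
  obtain ⟨S, φ, hφ, hf⟩ := f.2
  refine ⟨⟨S, fun y => φ y.2, (hφ.comp contDiff_snd).contDiffOn, fun _ _ => hf⟩, fun l _ p => ?_⟩
  exact hasDerivWithinAt_const l I (f.1 p)

theorem HasParamDerivSmooth.mul_const {c c' : ℂ → SmoothFun E} (h : HasParamDerivSmooth I c c')
    (f : SmoothFun E) : HasParamDerivSmooth I (fun l => c l * f) (fun l => c' l * f) := by
  classical
  obtain ⟨⟨S, φ, hφ, hc⟩, hd⟩ := h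
  obtain ⟨T, ψ, hψ, hf⟩ := f.2
  refine ⟨⟨S ∪ T, fun y => φ (y.1, fun s => y.2 ⟨s, Finset.mem_union_left _ s.2⟩) *
      ψ (fun s => y.2 ⟨s, Finset.mem_union_right _ s.2⟩), ?_, fun l hl p => ?_⟩, fun l hl p => ?_⟩
  · refine ContDiffOn.mul (hφ.comp (ContDiff.contDiffOn (by fun_prop)) fun y hy =>
      ⟨hy.1, Set.mem_univ _⟩) (hψ.comp (by fun_prop)).contDiffOn
  · change (c l).1 p * f.1 p = _
    rw [hc l hl, hf]
  · exact (hd l hl p).mul_const (f.1 p)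

/-- Allowing any finite index type makes sums of families immediate: the index types are added. -/
theorem HasParamDeriv.of_fintype {ι : Type} [Fintype ι] {f f' : ℂ → SuperFun E O}
    (c c' : ι → ℂ → SmoothFun E) (w : ι → Grassmann O)
    (hc : ∀ j, HasParamDerivSmooth I (c j) (c' j))
    (h : ∀ l ∈ I, f l = ∑ j, SuperFun.tmul (c j l) (w j) ∧
      f' l = ∑ j, SuperFun.tmul (c' j l) (w j)) : HasParamDeriv I f f' := by
  let e := (Fintype.equivFin ι).symm
  refine ⟨Fintype.card ι, fun j => c (e j), fun j => c' (e j), fun j => w (e j),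
    fun j => hc _, fun l hl => ?_⟩
  rw [(h l hl).1, (h l hl).2]
  exact ⟨(e.sum_comp fun j => SuperFun.tmul (c j l) (w j)).symm,
    (e.sum_comp fun j => SuperFun.tmul (c' j l) (w j)).symm⟩

theorem HasParamDeriv.exists_tmul {f f' : ℂ → SuperFun E O} (h : HasParamDeriv I f f') :
    ∃ (N : ℕ) (c c' : Fin N → ℂ → SmoothFun E) (w : Fin N → Grassmann O),
      (∀ j, HasParamDerivSmooth I (c j) (c' j)) ∧
      ∀ l ∈ I, f l = ∑ j, SuperFun.tmul (c j l) (w j) ∧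
        f' l = ∑ j, SuperFun.tmul (c' j l) (w j) := h

theorem HasParamDeriv.add {f f' g g' : ℂ → SuperFun E O} (hf : HasParamDeriv I f f')
    (hg : HasParamDeriv I g g') :
    HasParamDeriv I (fun l => f l + g l) (fun l => f' l + g' l) := by
  obtain ⟨N, c, c', v, hc, hf⟩ := hf.exists_tmul
  obtain ⟨M, d, d', w, hd, hg⟩ := hg.exists_tmul
  refine .of_fintype (Sum.elim c d) (Sum.elim c' d') (Sum.elim v w)
    (by rintro (j | j) <;> simp [hc, hd]) fun l hl => ?_
  simp only [(hf l hl).1, (hf l hl).2, (hg l hl).1, (hg l hl).2, Fintype.sum_sum_type,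
    Sum.elim_inl, Sum.elim_inr, and_self]

theorem HasParamDeriv.const (f : SuperFun E O) : HasParamDeriv I (fun _ => f) (fun _ => 0) := by
  induction f using SuperFun.induction with
  | zero => exact .of_fintype (ι := Empty) Empty.elim Empty.elim Empty.elim (by rintro ⟨⟩) (by simp)
  | tmul g w =>
    refine .of_fintype (ι := Unit) (fun _ _ => g) (fun _ _ => 0) (fun _ => w)
      (fun _ => .const g) fun l _ => ?_
    simp only [Finset.univ_unique, Finset.sum_const, Finset.card_singleton, one_smul, true_and]
    exact (TensorProduct.zero_tmul _ _).symm
  | add x y hx hy => simpa using hx.add hy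

theorem HasParamDeriv.sum {ι : Type} (s : Finset ι) {f f' : ι → ℂ → SuperFun E O}
    (h : ∀ i, HasParamDeriv I (f i) (f' i)) :
    HasParamDeriv I (fun l => ∑ i ∈ s, f i l) (fun l => ∑ i ∈ s, f' i l) := by
  classical
  induction s using Finset.induction_on with
  | empty => simpa using HasParamDeriv.const (I := I) (0 : SuperFun E O)
  | insert a s ha ih => simpa only [Finset.sum_insert ha] using (h a).add ih

/-- Fixed factors suffice: the coefficients a enter the prolonged derivatives linearly, so no
product rule in λ is needed. -/
theorem HasParamDeriv.mul_const {f f' : ℂ → SuperFun E O} (h : HasParamDeriv I f f')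
    (g : SuperFun E O) : HasParamDeriv I (fun l => f l * g) (fun l => f' l * g) := by
  induction g using SuperFun.induction with
  | zero => simpa using HasParamDeriv.const (I := I) (0 : SuperFun E O)
  | tmul g w =>
    obtain ⟨N, c, c', v, hc, hf⟩ := h.exists_tmul
    refine .of_fintype (fun j l => c j l * g) (fun j l => c' j l * g) (fun j => v j * w)
      (fun j => (hc j).mul_const g) fun l hl => ?_
    simp only [(hf l hl).1, (hf l hl).2, Finset.sum_mul, SuperFun.tmul_mul_tmul, and_self]
  | add x y hx hy => simpa only [mul_add] using hx.add hy

theorem HasParamDeriv.neg {f f' : ℂ → SuperFun E O} (h : HasParamDeriv I f f') :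
    HasParamDeriv I (fun l => -f l) (fun l => -f' l) := by
  simpa only [mul_neg, mul_one] using h.mul_const (-1)

theorem HasParamDeriv.pull {E' O' : Type} (e : E → E') (o : O → O') {f f' : ℂ → SuperFun E O}
    (h : HasParamDeriv I f f') :
    HasParamDeriv I (fun l => SuperPDE.pull e o (f l)) (fun l => SuperPDE.pull e o (f' l)) := by
  classical
  obtain ⟨N, c, c', v, hc, hf⟩ := h.exists_tmul
  -- This is the smooth component of `pull`, written out so that the expansions at the end agree
  -- definitionally.
  let P : SmoothFun E → SmoothFun E' := fun f => ⟨fun p => f.1 (fun i => p (e i)), by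
    obtain ⟨S, φ, hφ, hf⟩ := f.2
    exact ⟨S.image e, fun y => φ (fun s => y ⟨e s, Finset.mem_image_of_mem e s.2⟩),
      hφ.comp (by fun_prop), fun p => by simp [hf]⟩⟩
  refine .of_fintype (fun j l => P (c j l)) (fun j l => P (c' j l))
    (fun j => ExteriorAlgebra.map (Finsupp.lmapDomain ℂ ℂ o) (v j)) (fun j => ?_) fun l hl => ?_
  · obtain ⟨⟨S, φ, hφ, hc⟩, hd⟩ := hc j
    refine ⟨⟨S.image e, fun y => φ (y.1, fun s => y.2 ⟨e s, Finset.mem_image_of_mem e s.2⟩),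
      hφ.comp (ContDiff.contDiffOn (by fun_prop)) fun y hy => ⟨hy.1, Set.mem_univ _⟩,
      fun l hl p => ?_⟩, fun l hl p => ?_⟩
    · exact hc l hl _
    · exact hd l hl fun i => p (e i)
  · rw [(hf l hl).1, (hf l hl).2, map_sum, map_sum]
    exact ⟨rfl, rfl⟩

end ParamDeriv

/-! ### The Frölicher-Nijenhuis bracket with a characteristic element -/

section Lie

variable {E O : Type}

theorem EvenField.lie_sub [DecidableEq E] (X : EvenField E O) (η θ : Form1 E O) :
    X.lie (η - θ) = X.lie η - X.lie θ := by
  simp only [EvenField.lie, map_sub]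
  abel

theorem EvenField.lie_sum [DecidableEq E] (X : EvenField E O) {ι : Type} (s : Finset ι)
    (η : ι → Form1 E O) : X.lie (∑ i ∈ s, η i) = ∑ i ∈ s, X.lie (η i) := by
  simp only [EvenField.lie, map_sum, Finset.sum_add_distrib]

/-- Cartan's formula loses its first term to d² = 0, and substituting `X` into `d0 f` gives `X(f)`.
-/
theorem EvenField.lie_d0 [DecidableEq E] (X : EvenField E O) (f : SuperFun E O) :
    X.lie (d0 f) = d0 (X.coef.apply f) := by
  rw [EvenField.lie, d1_d0, map_zero, zero_add]
  rfl

/-- The Lie derivative of `dz^j h` along a vector field with `X(z^j) = 0`. -/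
theorem EvenField.lie_single [DecidableEq E] (X : EvenField E O) {j : E ⊕ O} (hj : X.coef j = 0)
    (h : SuperFun E O) :
    X.lie (Finsupp.single j h) = Finsupp.single j (X.coef.apply h) := by
  have h1 : X.i1 (Finsupp.single j h) = 0 := by
    rw [EvenField.i1, Finsupp.lsum_single, hj, LinearMap.mulLeft_apply, zero_mul]
  rw [EvenField.lie, h1, map_zero, add_zero, d1, LinearMap.comp_apply, Submodule.mkQ_apply,
    EvenField.i2, Submodule.liftQ_apply, Finsupp.lsum_single, LinearMap.neg_apply,
    LinearMap.comp_apply, map_neg, Finsupp.lmapDomain_apply, Finsupp.lsum_apply,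
    Finsupp.sum_mapDomain_index (fun _ => map_zero _) (fun _ => map_add _), VectorField.apply,
    Finsupp.sum, Finsupp.sum, ← Finsupp.lsingle_apply (R := ℂ), map_sum, ← Finset.sum_neg_distrib]
  refine Finset.sum_congr rfl fun k _ => ?_
  -- Only the second term of `i_X (dz^j ∧ dz^k)` survives; its minus sign cancels the one in `d1`.
  have h2 : Form1.mulLeft (X.coef j) (Finsupp.single k (d0 h k)) = 0 := by
    have : twist (par k) (0 : SuperFun E O) = 0 := map_zero _
    rw [Form1.mulLeft, Finsupp.lsum_single, hj, this, LinearMap.comp_apply,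
      LinearMap.mulLeft_apply, zero_mul, map_zero]
  rw [LinearMap.sub_apply, LinearMap.comp_apply, Finsupp.lsingle_apply, h2, zero_sub, neg_neg]
  rfl

/-- Both halves of the bracket contain `d(X f)`, which cancels. What remains along `dx^i` is `D_i (X
f) - X (D_i f)`, since `X` does not move `x^i`. -/
theorem fnBracket_charElement {n m₀ m₁ k₀ k₁ : ℕ} (X : EvenField (CovE n m₀ k₀) (CovO n m₁ k₁))
    (hX : ∀ i, X.coef (Sum.inl (Sum.inl (Sum.inl i))) = 0)
    (D : Fin n → VectorField (CovE n m₀ k₀) (CovO n m₁ k₁)) (hD : ∀ i, (D i).HasParity 0)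
    (f : SuperFun (CovE n m₀ k₀) (CovO n m₁ k₁)) :
    fnBracket X (charElement D) f = ∑ i, Finsupp.single (Sum.inl (Sum.inl (Sum.inl i)))
      ((VectorField.bracket 0 0 (D i) X.coef).apply f) := by
  rw [fnBracket, charElement, charElement, X.lie_sub, X.lie_d0, X.lie_sum, sub_sub_sub_cancel_left,
    ← Finset.sum_sub_distrib]
  refine Finset.sum_congr rfl fun i _ => ?_
  rw [X.lie_single (hX i), ← Finsupp.single_sub, VectorField.bracket_apply (hD i) X.even]

end Lie
-- The vertical field and the prolonged total derivatives on the covering.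
section Main

variable {n m₀ m₁ k₀ k₁ r : ℕ} {𝔤 : MatLieSuper k₀ k₁}

theorem gField_apply_eq_zero (b : 𝔤.HomBasis r) (ϱ : 𝔤.VectRep) (q : GFun n m₀ m₁ b)
    (f : JetFun n m₀ m₁) : (gField b ϱ q).coef.apply (fromJet f) = 0 := by
  obtain ⟨S, hS⟩ := exists_pderiv_support {f}
  simp only [Finset.mem_singleton, forall_eq] at hS
  rw [fromJet, VectorField.apply_pull Sum.inl_injective Sum.inl_injective _ f hS]
  refine Finset.sum_eq_zero fun j _ => ?_
  rcases j with j | j <;> exact zero_mul _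

theorem prolongedD_apply_fromJet (b : 𝔤.HomBasis r) (ϱ : 𝔤.VectRep) (a : Fin n → GFun n m₀ m₁ b)
    (i : Fin n) (f : JetFun n m₀ m₁) :
    (prolongedD b ϱ a i).apply (fromJet f) = fromJet ((totalD i).apply f) := by
  obtain ⟨S, hS⟩ := exists_pderiv_support {f}
  simp only [Finset.mem_singleton, forall_eq] at hS
  rw [fromJet, VectorField.apply_pull Sum.inl_injective Sum.inl_injective _ f hS,
    VectorField.apply_eq_sum _ f hS, map_sum]
  refine Finset.sum_congr rfl fun j _ => ?_
  rw [map_mul]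
  rcases j with j | j <;> rfl

/-- The horizontal part `H` is arbitrary, so this serves both X (`H = 0`) and, after a change of
sign, the prolonged derivatives. -/
theorem combine_apply_fromW (H : JetE n m₀ ⊕ JetO n m₁ → SuperFun (CovE n m₀ k₀) (CovO n m₁ k₁))
    (b : 𝔤.HomBasis r) (ϱ : 𝔤.VectRep) (q : Fin r → JetFun n m₀ m₁)
    (v : SuperFun (Fin k₀) (Fin k₁)) :
    (combine H (vertCoef b ϱ q)).apply (fromW v) =
      ∑ k, fromJet (q k) * fromW ((ϱ.map (b.e k)).apply v) := by
  obtain ⟨S, hS⟩ := exists_pderiv_support {v}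
  simp only [Finset.mem_singleton, forall_eq] at hS
  have h : ∀ j, combine H (vertCoef b ϱ q) (Sum.map Sum.inr Sum.inr j) = vertCoef b ϱ q j := by
    rintro (j | j) <;> rfl
  rw [fromW, VectorField.apply_pull Sum.inr_injective Sum.inr_injective _ v hS]
  simp only [h, vertCoef, Finset.sum_mul]
  rw [Finset.sum_comm]
  refine Finset.sum_congr rfl fun k _ => ?_
  rw [VectorField.apply_eq_sum _ v hS, map_sum, Finset.mul_sum]
  refine Finset.sum_congr rfl fun j _ => ?_
  rw [mul_assoc, map_mul]
  rfl

theorem vertCoef_neg (b : 𝔤.HomBasis r) (ϱ : 𝔤.VectRep) (q : Fin r → JetFun n m₀ m₁) :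
    vertCoef b ϱ (-q) = -vertCoef b ϱ q := by
  funext j
  simp only [vertCoef, Pi.neg_apply, map_neg, neg_mul, Finset.sum_neg_distrib]

theorem vertCoef_sub (b : 𝔤.HomBasis r) (ϱ : 𝔤.VectRep) (q q' : Fin r → JetFun n m₀ m₁) :
    vertCoef b ϱ (q - q') = vertCoef b ϱ q - vertCoef b ϱ q' := by
  funext j
  simp only [vertCoef, Pi.sub_apply, map_sub, sub_mul, Finset.sum_sub_distrib]

theorem prolongedD_apply_fromW (b : 𝔤.HomBasis r) (ϱ : 𝔤.VectRep) (a : Fin n → GFun n m₀ m₁ b)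
    (i : Fin n) (v : SuperFun (Fin k₀) (Fin k₁)) :
    (prolongedD b ϱ a i).apply (fromW v) =
      -∑ k, fromJet ((a i).coef k) * fromW ((ϱ.map (b.e k)).apply v) := by
  have h := combine_apply_fromW (fun j => fromJet (totalD i j)) b ϱ (-(a i).coef) v
  rw [vertCoef_neg] at h
  refine h.trans ?_
  simp only [Pi.neg_apply, map_neg, neg_mul, Finset.sum_neg_distrib]

theorem totalD_hasParity (i : Fin n) :
    (totalD i : VectorField (JetE n m₀) (JetO n m₁)).HasParity 0 := by
  rintro ((j | ⟨k, J⟩) | ⟨k, J⟩) <;> rw [zero_add]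
  · change HasParity 0 (if j = i then 1 else 0)
    split_ifs
    exacts [HasParity.one, HasParity.zero _]
  · exact hasParity_coord (Sum.inl (Sum.inr (k, J + Pi.single i 1)))
  · exact hasParity_coord (Sum.inr (k, J + Pi.single i 1))

theorem prolongedD_hasParity (b : 𝔤.HomBasis r) (ϱ : 𝔤.VectRep) (a : Fin n → GFun n m₀ m₁ b)
    (i : Fin n) : (prolongedD b ϱ a i).HasParity 0 := by
  rintro ((j | p) | (j | p))
  · exact (totalD_hasParity i (Sum.inl j)).pull _ _
  · rw [zero_add]
    exact (vertCoef_hasParity b ϱ (a i) (Sum.inl p)).neg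
  · exact (totalD_hasParity i (Sum.inr j)).pull _ _
  · rw [zero_add]
    exact (vertCoef_hasParity b ϱ (a i) (Sum.inr p)).neg

/-! ### Brackets of 𝔤-valued functions under ρ and ϱ. -/

/-- The supercommutator of two elements of a homogeneous basis. -/
noncomputable def MatLieSuper.HomBasis.comm (b : 𝔤.HomBasis r) (m k : Fin r) : 𝔤.space :=
  ⟨superComm (b.parity m) (b.parity k) (b.e m).1 (b.e k).1,
    𝔤.bracket_mem _ _ _ _ (b.e m).2 (b.e k).2 (b.homogeneous m) (b.homogeneous k)⟩

/-- The coefficients of the bracket `[a^m e_m, q^k e_k]` of even `𝔤`-valued functions. -/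
noncomputable def bracketCoef (b : 𝔤.HomBasis r) (a q : Fin r → JetFun n m₀ m₁) (p : Fin r) :
    JetFun n m₀ m₁ :=
  ∑ m, ∑ k, (sgn (b.parity m) (b.parity k) * b.e.repr (b.comm m k) p) • (a m * q k)

/-- Linearity of ϱ resums the structure constants, which leaves the images of commutators ready for
the bracket relation of ϱ. -/
theorem vertCoef_bracketCoef (b : 𝔤.HomBasis r) (ϱ : 𝔤.VectRep) (a q : Fin r → JetFun n m₀ m₁)
    (j : Fin k₀ ⊕ Fin k₁) :
    vertCoef b ϱ (bracketCoef b a q) j = ∑ m, ∑ k, sgn (b.parity m) (b.parity k) •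
      (fromJet (a m * q k) * fromW (ϱ.map (b.comm m k) j)) := by
  have h : ∀ m k, ϱ.map (b.comm m k) j =
      ∑ p, b.e.repr (b.comm m k) p • ϱ.map (b.e p) j := fun m k => by
    conv_lhs => rw [← b.e.sum_repr (b.comm m k), map_sum, Finset.sum_apply]
    exact Finset.sum_congr rfl fun p _ => by rw [map_smul]; rfl
  simp only [vertCoef, bracketCoef, map_sum, Finset.sum_mul, h, Finset.mul_sum, Finset.smul_sum,
    map_smul, smul_mul_assoc, mul_smul_comm, smul_smul]
  rw [Finset.sum_comm]
  exact Finset.sum_congr rfl fun m _ => Finset.sum_comm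

/-- Since ρ preserves supercommutators, the matrix bracket has the structure constants of 𝔤, the
same ones that govern the vector fields. -/
theorem evenBracket_gMatrix (b : 𝔤.HomBasis r) (ρ : 𝔤.MatRep) (a : Fin r → JetFun n m₀ m₁)
    (q : GFun n m₀ m₁ b) (ha : ∀ k, HasParity (b.parity k) (a k)) :
    evenBracket (gMatrix b ρ a) (gMatrix b ρ q.coef) = gMatrix b ρ (bracketCoef b a q.coef) := by
  have mul : ∀ (a q : Fin r → JetFun n m₀ m₁) (_ : ∀ k, HasParity (b.parity k) (q k)) s u,
      superMul (gMatrix b ρ a) (gMatrix b ρ q) s u =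
        ∑ m, ∑ k, (sgn (b.parity m) (b.parity k) * (ρ.map (b.e m) * ρ.map (b.e k)) s u) •
          (a m * q k) := by
    intro a q hq s u
    simp only [superMul, gMatrix, map_sum, map_smul, Finset.sum_mul, Finset.mul_sum,
      Matrix.mul_apply, Finset.sum_smul]
    rw [Finset.sum_congr rfl fun t _ => Finset.sum_comm, Finset.sum_comm]
    refine Finset.sum_congr rfl fun m _ => ?_
    rw [Finset.sum_comm]
    refine Finset.sum_congr rfl fun k _ => Finset.sum_congr rfl fun t _ => ?_
    -- A nonzero entry of the homogeneous matrix `ρ(e_m)` has position parity `p(e_m)`, which turns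
    -- the entrywise twist into one sign for all `t`.
    by_cases h0 : ρ.map (b.e m) s t = 0
    · simp [h0]
    · rw [ρ.parity _ _ (b.homogeneous m) s t h0, twist_of_hasParity (hq k), smul_mul_smul_comm,
        mul_smul_comm, smul_smul]
      congr 1
      ring
  funext s u
  have h : ∀ m k, ρ.map (b.comm m k) s u =
      ∑ p, b.e.repr (b.comm m k) p * ρ.map (b.e p) s u := fun m k => by
    conv_lhs => rw [← b.e.sum_repr (b.comm m k), map_sum, Matrix.sum_apply]
    exact Finset.sum_congr rfl fun p _ => by rw [map_smul]; rfl
  have h1 : gMatrix b ρ (bracketCoef b a q.coef) s u = ∑ m, ∑ k,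
      (sgn (b.parity m) (b.parity k) * ρ.map (b.comm m k) s u) • (a m * q.coef k) := by
    simp only [gMatrix, bracketCoef, h, Finset.mul_sum, Finset.sum_smul, Finset.smul_sum, smul_smul]
    rw [Finset.sum_comm]
    refine Finset.sum_congr rfl fun m _ => ?_
    rw [Finset.sum_comm]
    refine Finset.sum_congr rfl fun k _ => Finset.sum_congr rfl fun p _ => ?_
    congr 1
    ring
  rw [h1]
  change superMul _ _ s u - superMul _ _ s u = _
  rw [mul _ _ q.even, mul _ _ ha, Finset.sum_comm (f := fun m k =>
    (sgn (b.parity m) (b.parity k) * (ρ.map (b.e m) * ρ.map (b.e k)) s u) • (q.coef m * a k)),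
    ← Finset.sum_sub_distrib]
  refine Finset.sum_congr rfl fun m _ => ?_
  rw [← Finset.sum_sub_distrib]
  refine Finset.sum_congr rfl fun k _ => ?_
  have h2 : ρ.map (b.comm m k) s u = (ρ.map (b.e m) * ρ.map (b.e k)) s u -
      sgn (b.parity m) (b.parity k) * (ρ.map (b.e k) * ρ.map (b.e m)) s u :=
    congrFun (congrFun (ρ.bracket _ _ _ _ (b.homogeneous m) (b.homogeneous k)) s) u
  -- Reordering `q^k a^m` squares away the sign of the product `Q α`, just as the outer sign does in
  -- the second term of the supercommutator.
  rw [h2, (q.even k).mul_comm_sgn (ha m), smul_smul, ← sub_smul,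
    sgn_comm (b.parity k) (b.parity m)]
  congr 1
  have := sgn_mul_self (b.parity m) (b.parity k)
  ring

/-- The commutator of the prolonged total derivatives with the vector field `q^k ϱ(e_k)`. -/
theorem bracket_prolongedD_gField (b : 𝔤.HomBasis r) (ϱ : 𝔤.VectRep) (a : Fin n → GFun n m₀ m₁ b)
    (q : GFun n m₀ m₁ b) (i : Fin n) :
    VectorField.bracket 0 0 (prolongedD b ϱ a i) (gField b ϱ q).coef =
      combine (fun _ => 0) (vertCoef b ϱ
        ((fun p => (totalD i).apply (q.coef p)) - bracketCoef b (a i).coef q.coef)) := by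
  have hX := (gField b ϱ q).even
  have hD := prolongedD_hasParity b ϱ a i
  have key : ∀ j, (prolongedD b ϱ a i).apply (vertCoef b ϱ q.coef j) -
      (gField b ϱ q).coef.apply (-vertCoef b ϱ (a i).coef j) = vertCoef b ϱ
        ((fun p => (totalD i).apply (q.coef p)) - bracketCoef b (a i).coef q.coef) j := by
    intro j
    rw [vertCoef_sub, Pi.sub_apply, vertCoef_bracketCoef, ← VectorField.applyLin_apply,
      ← VectorField.applyLin_apply, map_neg]
    simp only [vertCoef, map_sum, VectorField.applyLin_apply, hX.apply_mul, hD.apply_mul,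
      gField_apply_eq_zero, zero_mul, zero_add, prolongedD_apply_fromJet, prolongedD_apply_fromW,
      Finset.sum_add_distrib, sub_neg_eq_add]
    -- The terms with `D_{x^i} q^k` already match; the rest is bilinear in `a` and `q` and must
    -- equal minus the bracket, the minus coming from the definition of `D_i`.
    rw [add_assoc, sub_eq_add_neg]
    congr 1
    have h1 : ∀ v, (gField b ϱ q).coef.apply (fromW v) =
      ∑ k, fromJet (q.coef k) * fromW ((ϱ.map (b.e k)).apply v) :=
        combine_apply_fromW (fun _ => 0) b ϱ q.coef
    have h2 : ∀ m k, ϱ.map (b.comm m k) j = (ϱ.map (b.e m)).apply (ϱ.map (b.e k) j) -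
        sgn (b.parity m) (b.parity k) • (ϱ.map (b.e k)).apply (ϱ.map (b.e m) j) := fun m k =>
      congrFun (ϱ.bracket _ _ _ _ (b.homogeneous m) (b.homogeneous k)) j
    simp only [h1, h2, mul_neg, Finset.sum_neg_distrib, Finset.mul_sum]
    rw [Finset.sum_comm, neg_add_eq_sub, ← neg_sub, neg_inj, ← Finset.sum_sub_distrib]
    refine Finset.sum_congr rfl fun m _ => ?_
    rw [← Finset.sum_sub_distrib]
    refine Finset.sum_congr rfl fun k _ => ?_
    rw [← mul_assoc, ← mul_assoc, ← map_mul, ← map_mul,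
      (q.even k).mul_comm_sgn ((a i).even m), sgn_comm (b.parity k), map_sub, map_smul, map_smul,
      mul_sub, smul_sub, mul_smul_comm, smul_smul, sgn_mul_self, one_smul, smul_mul_assoc]
  funext j
  rcases j with (j | j) | (j | j)
  -- Along the jet space X has zero components, and those of `D_i` are pulled back from it, so X
  -- annihilates them.
  · change (prolongedD b ϱ a i).apply 0 - sgn 0 0 • (gField b ϱ q).coef.apply (fromJet _) = 0
    rw [gField_apply_eq_zero, smul_zero, sub_zero]
    exact map_zero (prolongedD b ϱ a i).applyLin
  · refine Eq.trans ?_ (key (Sum.inl j))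
    rw [VectorField.bracket, sgn_zero_left, one_smul]
    rfl
  · change (prolongedD b ϱ a i).apply 0 - sgn 0 0 • (gField b ϱ q).coef.apply (fromJet _) = 0
    rw [gField_apply_eq_zero, smul_zero, sub_zero]
    exact map_zero (prolongedD b ϱ a i).applyLin
  · refine Eq.trans ?_ (key (Sum.inr j))
    rw [VectorField.bracket, sgn_zero_left, one_smul]
    rfl

theorem totalDMat_gMatrix (b : 𝔤.HomBasis r) (ρ : 𝔤.MatRep) (q : Fin r → JetFun n m₀ m₁)
    (i : Fin n) :
    totalDMat i (gMatrix b ρ q) = gMatrix b ρ fun p => (totalD i).apply (q p) := by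
  funext s t
  change (totalD i).applyLin (∑ k, ρ.map (b.e k) s t • q k) = _
  simp only [map_sum, map_smul]
  rfl

theorem gMatrix_sub (b : 𝔤.HomBasis r) (ρ : 𝔤.MatRep) (q q' : Fin r → JetFun n m₀ m₁) :
    gMatrix b ρ (q - q') = gMatrix b ρ q - gMatrix b ρ q' := by
  funext s t
  change _ = gMatrix b ρ q s t - gMatrix b ρ q' s t
  simp only [gMatrix, Pi.sub_apply, smul_sub, Finset.sum_sub_distrib]

/-! ### Vanishing on the equation and on the covering. -/

theorem smul_mem_twoSidedIdeal {R : Type} [Ring R] [Algebra ℂ R] (J : TwoSidedIdeal R) (c : ℂ)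
    {x : R} (hx : x ∈ J) : c • x ∈ J := by
  rw [Algebra.smul_def]
  exact J.mul_mem_left _ _ hx

/-- As `ρ` is faithful, the coefficients of a `𝔤`-matrix that vanishes on `𝓔^∞` vanish. -/
theorem vanishes_of_gMatrix (𝓔 : PDESystem n m₀ m₁) (b : 𝔤.HomBasis r) (ρ : 𝔤.MatRep)
    {g : Fin r → JetFun n m₀ m₁} (h : 𝓔.MatVanishes (gMatrix b ρ g)) (p : Fin r) :
    𝓔.Vanishes (g p) := by
  obtain ⟨φ, hφ⟩ := LinearMap.exists_leftInverse_of_injective ρ.map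
    (LinearMap.ker_eq_bot.2 ρ.injective)
  -- A functional on complex matrices dual to `ρ(e_p)`; applied entrywise to the 𝔤-matrix it
  -- extracts the coefficient `g p`.
  let ψ : Mat k₀ k₁ ℂ →ₗ[ℂ] ℂ := (b.e.coord p).comp φ
  have h1 : ∀ A : Mat k₀ k₁ ℂ, ψ A = ∑ s, ∑ t, A s t * ψ (Matrix.single s t 1) := fun A => by
    conv_lhs => rw [Matrix.matrix_eq_sum_single A]
    simp only [map_sum]
    refine Finset.sum_congr rfl fun s _ => Finset.sum_congr rfl fun t _ => ?_
    rw [← smul_eq_mul, ← map_smul, Matrix.smul_single, smul_eq_mul, mul_one]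
  have h2 : ∀ k, ψ (ρ.map (b.e k)) = if k = p then 1 else 0 := fun k => by
    change b.e.coord p ((φ ∘ₗ ρ.map) (b.e k)) = _
    rw [hφ, LinearMap.id_apply, Module.Basis.coord_apply,
      Module.Basis.repr_self, Finsupp.single_apply]
  have h3 : g p = ∑ s, ∑ t, ψ (Matrix.single s t 1) • gMatrix b ρ g s t := by
    have h4 : g p = ∑ k, ψ (ρ.map (b.e k)) • g k := by
      simp only [h2, ite_smul, one_smul, zero_smul, Finset.sum_ite_eq', Finset.mem_univ, if_true]
    rw [h4]
    simp only [h1 (ρ.map _), gMatrix, Finset.sum_smul, Finset.smul_sum, smul_smul]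
    rw [Finset.sum_comm]
    refine Finset.sum_congr rfl fun s _ => ?_
    rw [Finset.sum_comm]
    exact Finset.sum_congr rfl fun t _ => Finset.sum_congr rfl fun k _ => by rw [mul_comm]
  rw [h3]
  exact sum_mem fun s _ => sum_mem fun t _ => smul_mem_twoSidedIdeal _ _ (h s t)

theorem PDESystem.Vanishes.fromJet {𝓔 : PDESystem n m₀ m₁} {f : JetFun n m₀ m₁}
    (h : 𝓔.Vanishes f) : 𝓔.CovVanishes (k₀ := k₀) (k₁ := k₁) (SuperPDE.fromJet f) := by
  have : TwoSidedIdeal.span {h | 𝓔.Consequence h} ≤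
      (TwoSidedIdeal.span {h | ∃ g, 𝓔.Consequence g ∧ h = SuperPDE.fromJet g}).comap
        (SuperPDE.fromJet (k₀ := k₀) (k₁ := k₁)) :=
    TwoSidedIdeal.span_le.2 fun g hg =>
      (TwoSidedIdeal.mem_comap _).2 (TwoSidedIdeal.subset_span ⟨g, hg, rfl⟩)
  exact (TwoSidedIdeal.mem_comap _).1 (this h)

/-- Elements of the ideal occur here only as coefficients of the field and are never differentiated,
so the ideal property alone suffices. -/
theorem covVanishes_apply (𝓔 : PDESystem n m₀ m₁) (b : 𝔤.HomBasis r) (ϱ : 𝔤.VectRep)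
    {g : Fin r → JetFun n m₀ m₁} (h : ∀ p, 𝓔.Vanishes (g p))
    (f : SuperFun (CovE n m₀ k₀) (CovO n m₁ k₁)) :
    𝓔.CovVanishes ((combine (fun _ => 0) (vertCoef b ϱ g)).apply f) := by
  refine sum_mem fun j _ => TwoSidedIdeal.mul_mem_right _ _ _ ?_
  have hv : ∀ i, 𝓔.CovVanishes (vertCoef b ϱ g i) := fun i =>
    sum_mem fun k _ => TwoSidedIdeal.mul_mem_right _ _ _ (h k).fromJet
  rcases j with (j | j) | (j | j)
  exacts [TwoSidedIdeal.zero_mem _, hv (Sum.inl j), TwoSidedIdeal.zero_mem _, hv (Sum.inr j)]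

theorem combine_sub (V V' : Fin k₀ ⊕ Fin k₁ → SuperFun (CovE n m₀ k₀) (CovO n m₁ k₁)) :
    combine (fun _ => 0) (V - V') = combine (fun _ => 0) V - combine (fun _ => 0) V' := by
  funext j
  rcases j with (j | j) | (j | j)
  exacts [(sub_zero _).symm, rfl, (sub_zero _).symm, rfl]

theorem VectorField.sub_apply {E O : Type} [DecidableEq E] (X Y : VectorField E O)
    (f : SuperFun E O) : VectorField.apply (X - Y) f = X.apply f - Y.apply f := by
  simp only [VectorField.apply, Finsupp.sum, Pi.sub_apply, sub_mul, Finset.sum_sub_distrib]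

/-! ### Differentiating the characteristic element in the parameter. -/

theorem hasParamDeriv_vertCoef {I : Set ℂ} (b : 𝔤.HomBasis r) (ϱ : 𝔤.VectRep)
    {a a' : ℂ → Fin r → JetFun n m₀ m₁}
    (h : ∀ k, HasParamDeriv I (fun l => a l k) (fun l => a' l k)) (j : Fin k₀ ⊕ Fin k₁) :
    HasParamDeriv I (fun l => vertCoef b ϱ (a l) j) (fun l => vertCoef b ϱ (a' l) j) :=
  HasParamDeriv.sum _ fun k => ((h k).pull _ _).mul_const _

theorem hasParamDeriv_prolongedD_apply {I : Set ℂ} (b : 𝔤.HomBasis r) (ϱ : 𝔤.VectRep)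
    {a : ℂ → Fin n → GFun n m₀ m₁ b} {a' : ℂ → Fin n → Fin r → JetFun n m₀ m₁}
    (ha : ∀ i k, HasParamDeriv I (fun l => (a l i).coef k) (fun l => a' l i k)) (i : Fin n)
    (f : SuperFun (CovE n m₀ k₀) (CovO n m₁ k₁)) :
    HasParamDeriv I (fun l => (prolongedD b ϱ (a l) i).apply f)
      (fun l => -(combine (fun _ => 0) (vertCoef b ϱ (a' l i))).apply f) := by
  simp only [VectorField.apply, Finsupp.sum, ← Finset.sum_neg_distrib, ← neg_mul]
  refine HasParamDeriv.sum _ fun j => HasParamDeriv.mul_const ?_ _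
  have hv := fun j => (hasParamDeriv_vertCoef b ϱ (ha i) j).neg
  -- The horizontal coefficients do not depend on λ; `-0` is the form in which their derivative
  -- appears in the goal.
  have h0 : ∀ f : SuperFun (CovE n m₀ k₀) (CovO n m₁ k₁),
      HasParamDeriv I (fun _ => f) (fun _ => -0) := fun f => by
    simpa only [neg_zero] using HasParamDeriv.const f
  rcases j with (j | j) | (j | j)
  exacts [h0 _, hv (Sum.inl j), h0 _, hv (Sum.inr j)]

theorem hasParamDerivForm_charElement {I : Set ℂ} (b : 𝔤.HomBasis r) (ϱ : 𝔤.VectRep)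
    {a : ℂ → Fin n → GFun n m₀ m₁ b} {a' : ℂ → Fin n → Fin r → JetFun n m₀ m₁}
    (ha : ∀ i k, HasParamDeriv I (fun l => (a l i).coef k) (fun l => a' l i k))
    (f : SuperFun (CovE n m₀ k₀) (CovO n m₁ k₁)) :
    HasParamDerivForm I (fun l => charElement (prolongedD b ϱ (a l)) f)
      (fun l => ∑ i, Finsupp.single (Sum.inl (Sum.inl (Sum.inl i)))
        ((combine (fun _ => 0) (vertCoef b ϱ (a' l i))).apply f)) := by
  classical
  let x : Fin n → CovE n m₀ k₀ ⊕ CovO n m₁ k₁ := fun i => Sum.inl (Sum.inl (Sum.inl i))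
  have hs : ∀ (g : Fin n → SuperFun (CovE n m₀ k₀) (CovO n m₁ k₁)) j, j ∉ Finset.univ.image x →
      (∑ i, Finsupp.single (x i) (g i)) j = 0 := fun g j hj => by
    rw [Finsupp.finsetSum_apply]
    refine Finset.sum_eq_zero fun i _ => Finsupp.single_eq_of_ne fun h => hj ?_
    rw [h]
    exact Finset.mem_image_of_mem _ (Finset.mem_univ i)
  have hU : ∀ D : Fin n → VectorField (CovE n m₀ k₀) (CovO n m₁ k₁), ∀ j, charElement D f j =
      d0 f j - (∑ i, Finsupp.single (x i) ((D i).apply f)) j := fun _ _ => rfl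
  -- λ affects only the `dx^i` components, so the support of `d0 f` together with the `x^i` bounds
  -- all supports uniformly.
  refine ⟨⟨(d0 f).support ∪ Finset.univ.image x, fun l _ => ⟨fun j hj => ?_, fun j hj => ?_⟩⟩,
    fun j => ?_⟩
  · by_contra h
    rw [Finset.mem_union, not_or, Finsupp.notMem_support_iff] at h
    refine Finsupp.mem_support_iff.1 hj ?_
    rw [hU, h.1, hs _ j h.2, sub_zero]
  · by_contra h
    rw [Finset.mem_union, not_or] at h
    exact Finsupp.mem_support_iff.1 hj (hs _ j h.2)
  · simp only [hU, Finsupp.finsetSum_apply, sub_eq_add_neg,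
      ← Finset.sum_neg_distrib]
    suffices h : HasParamDeriv I (fun l => ∑ i, -Finsupp.single (x i)
        ((prolongedD b ϱ (a l) i).apply f) j) (fun l => ∑ i, Finsupp.single (x i)
        ((combine (fun _ => 0) (vertCoef b ϱ (a' l i))).apply f) j) by
      simpa only [zero_add] using (HasParamDeriv.const (d0 f j)).add h
    refine HasParamDeriv.sum _ fun i => ?_
    by_cases hj : x i = j
    · simp only [hj, Finsupp.single_eq_same]
      simpa only [neg_neg] using (hasParamDeriv_prolongedD_apply b ϱ ha i f).neg
    · simp only [Finsupp.single_eq_of_ne (Ne.symm hj), neg_zero]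
      exact HasParamDeriv.const 0

end Main

end SuperPDE

theorem proposition2 {n m₀ m₁ k₀ k₁ r : ℕ} (𝓔 : SuperPDE.PDESystem n m₀ m₁)
    (𝔤 : SuperPDE.MatLieSuper k₀ k₁) (b : 𝔤.HomBasis r) (ρ : 𝔤.MatRep) (ϱ : 𝔤.VectRep)
    (I : Set ℂ)
    -- the family `α_λ = ∑_i dx^i a_i^k ρ(e_k)` and its derivative with respect to `λ`
    (a : ℂ → Fin n → SuperPDE.GFun n m₀ m₁ b)
    (a' : ℂ → Fin n → Fin r → SuperPDE.JetFun n m₀ m₁)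
    (ha : ∀ i k, SuperPDE.HasParamDeriv I (fun l => (a l i).coef k) (fun l => a' l i k))
    (hzcr : ∀ l ∈ I, SuperPDE.IsZCR 𝓔 (fun i => SuperPDE.gMatrix b ρ (a l i).coef))
    -- the matrices `Q_λ = q^k ρ(e_k)`
    (q : ℂ → SuperPDE.GFun n m₀ m₁ b)
    (hQ : ∀ l ∈ I, SuperPDE.MarvanEq 𝓔 (fun i => SuperPDE.gMatrix b ρ (a l i).coef)
      (fun i => SuperPDE.gMatrix b ρ (a' l i)) (SuperPDE.gMatrix b ρ (q l).coef)) :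
    𝓔.HasParamDerivOn I
      (fun l => SuperPDE.charElement (SuperPDE.prolongedD b ϱ (a l)))
      (fun l => SuperPDE.fnBracket (SuperPDE.gField b ϱ (q l))
        (SuperPDE.charElement (SuperPDE.prolongedD b ϱ (a l)))) := by
  intro f
  refine ⟨_, SuperPDE.hasParamDerivForm_charElement b ϱ ha f, fun l hl => ?_⟩
  beta_reduce
  rw [SuperPDE.fnBracket_charElement (SuperPDE.gField b ϱ (q l)) (fun _ => rfl) _
    (SuperPDE.prolongedD_hasParity b ϱ (a l)), ← Finset.sum_sub_distrib]
  -- The difference is a sum of forms `dx^i g`; each `g` is the value at `f` of a vertical field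
  -- with coefficients in the ideal, so the generators `(df) h` are not needed.
  refine Submodule.sum_mem _ fun i _ => Submodule.subset_span (Or.inl ⟨_, _, ?_,
    (Finsupp.single_sub _ _ _).symm⟩)
  rw [SuperPDE.bracket_prolongedD_gField, ← SuperPDE.VectorField.sub_apply,
    ← SuperPDE.combine_sub, ← SuperPDE.vertCoef_sub]
  refine SuperPDE.covVanishes_apply 𝓔 b ϱ (SuperPDE.vanishes_of_gMatrix 𝓔 b ρ ?_) f
  have h := hQ l hl i
  rwa [SuperPDE.totalDMat_gMatrix, SuperPDE.evenBracket_gMatrix b ρ _ _ (a l i).even,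
    ← SuperPDE.gMatrix_sub, ← SuperPDE.gMatrix_sub] at h
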